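/- All rings are associative with identity and all modules are unitary. A left $R$-module $M$ is *Gorenstein flat* if there is an exact sequence $\cdots\to F_1\to F_0\to F^0\to F^1\to\cdots$ of flat left $R$-modules with $M\cong\operatorname{Im}(F_0\to F^0)$ which stays exact under $I\otimes_R-$ for every injective right $R$-module $I$. A ring $R$ is *left GF-closed* if for every short exact sequence $0\to A\to B\to C\to 0$ of left $R$-modules with $A$ and $C$ Gorenstein flat, $B$ is Gorenstein flat; $R$ is *right coherent* if every finitely generated right ideal is finitely presented; and $\operatorname{wdim}(R)$ denotes the weak dimension of $R$, i.e. the supremum of the flat dimensions of all left $R$-modules. There exist left GF-closed rings $R$ with $\operatorname{wdim}(R)=\infty$, and there exist left GF-closed rings $S$ that are not right coherent. For all such $R$ and $S$, the direct product $\Gamma=R\times S$ satisfies: 1. $\Gamma$ is left GF-closed; 2. $\operatorname{wdim}(\Gamma)=\sup\{\operatorname{wdim}(R),\operatorname{wdim}(S)\}=\infty$; 3. $\Gamma$ is not right coherent. -/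

import Mathlib

open scoped TensorProduct

universe u

namespace GFRing

section Tensor

variable (R : Type u) [Ring R]

/-- The relations `(m r) ⊗ n = m ⊗ (r n)` in `M ⊗_ℤ N`, for a right `R`-module `M`
(a module over the opposite ring) and a left `R`-module `N`. -/
def balancedRel (M N : Type u) [AddCommGroup M] [Module Rᵐᵒᵖ M] [AddCommGroup N] [Module R N] :
    AddSubgroup (M ⊗[ℤ] N) :=
  AddSubgroup.closure
    {x | ∃ (m : M) (r : R) (n : N), x = (MulOpposite.op r • m) ⊗ₜ[ℤ] n - m ⊗ₜ[ℤ] (r • n)}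

/-- The tensor product `M ⊗_R N` of a right `R`-module `M` and a left `R`-module `N` over a
ring `R` that need not be commutative; it is an abelian group. -/
abbrev Tensor (M N : Type u) [AddCommGroup M] [Module Rᵐᵒᵖ M] [AddCommGroup N] [Module R N] :
    Type u :=
  (M ⊗[ℤ] N) ⧸ balancedRel R M N

variable {R}
variable {M M' N N' : Type u}
  [AddCommGroup M] [Module Rᵐᵒᵖ M] [AddCommGroup M'] [Module Rᵐᵒᵖ M']
  [AddCommGroup N] [Module R N] [AddCommGroup N'] [Module R N']

theorem balancedRel_le_comap (f : M →ₗ[Rᵐᵒᵖ] M') (g : N →ₗ[R] N') :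
    balancedRel R M N ≤ (balancedRel R M' N').comap
      (TensorProduct.map f.toAddMonoidHom.toIntLinearMap
        g.toAddMonoidHom.toIntLinearMap).toAddMonoidHom := by
  unfold balancedRel
  rw [AddSubgroup.closure_le]
  rintro _ ⟨m, r, n, rfl⟩
  apply AddSubgroup.subset_closure
  refine ⟨f m, r, g n, ?_⟩
  simp

/-- The map `f ⊗ g : M ⊗_R N → M' ⊗_R N'`, sending `m ⊗ n` to `f m ⊗ g n`. -/
def Tensor.map (f : M →ₗ[Rᵐᵒᵖ] M') (g : N →ₗ[R] N') : Tensor R M N →+ Tensor R M' N' :=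
  QuotientAddGroup.map _ _
    (TensorProduct.map f.toAddMonoidHom.toIntLinearMap
      g.toAddMonoidHom.toIntLinearMap).toAddMonoidHom
    (balancedRel_le_comap f g)

end Tensor

/-- The left `R`-module `N` is flat: `- ⊗_R N` preserves injectivity of homomorphisms of right
`R`-modules. -/
def IsFlat (R : Type u) [Ring R] (N : Type u) [AddCommGroup N] [Module R N] : Prop :=
  ∀ (X Y : Type u) [AddCommGroup X] [AddCommGroup Y] [Module Rᵐᵒᵖ X] [Module Rᵐᵒᵖ Y]
    (f : X →ₗ[Rᵐᵒᵖ] Y), Function.Injective f →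
      Function.Injective (Tensor.map f (LinearMap.id : N →ₗ[R] N))

/-- The left `R`-module `M` is Gorenstein flat. The modules `F i` with `i ≤ 0` are
`F_0, F_1, …` (downwards) and those with `i ≥ 1` are `F^0, F^1, …` (upwards), so that `d 0` is
the map `F_0 → F^0`. -/
def IsGorensteinFlat (R : Type u) [Ring R] (M : Type u) [AddCommGroup M] [Module R M] : Prop :=
  ∃ (F : ℤ → Type u) (_ : ∀ i, AddCommGroup (F i)) (_ : ∀ i, Module R (F i))
    (d : ∀ i, F i →ₗ[R] F (i + 1)),
    (∀ i, IsFlat R (F i)) ∧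
    (∀ i, Function.Exact (d i) (d (i + 1))) ∧
    Nonempty (M ≃ₗ[R] LinearMap.range (d 0)) ∧
    ∀ (I : Type u) [AddCommGroup I] [Module Rᵐᵒᵖ I], Module.Injective Rᵐᵒᵖ I →
      ∀ i, Function.Exact (Tensor.map (LinearMap.id : I →ₗ[Rᵐᵒᵖ] I) (d i))
        (Tensor.map (LinearMap.id : I →ₗ[Rᵐᵒᵖ] I) (d (i + 1)))

/-- `R` is left GF-closed: the class of Gorenstein flat left `R`-modules is closed under
extensions. -/
def IsLeftGFClosed (R : Type u) [Ring R] : Prop :=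
  ∀ (A B C : Type u) [AddCommGroup A] [AddCommGroup B] [AddCommGroup C]
    [Module R A] [Module R B] [Module R C] (f : A →ₗ[R] B) (g : B →ₗ[R] C),
    Function.Injective f → Function.Exact f g → Function.Surjective g →
      IsGorensteinFlat R A → IsGorensteinFlat R C → IsGorensteinFlat R B

/-- There is an exact sequence `0 → F_n → ⋯ → F_0 → M → 0` of left `R`-modules with all `F_i`
flat (extended by `F_i = 0` for `i > n`). -/
def HasFlatDimLE (R : Type u) [Ring R] (M : Type u) [AddCommGroup M] [Module R M] (n : ℕ) :
    Prop :=
  ∃ (F : ℕ → Type u) (_ : ∀ i, AddCommGroup (F i)) (_ : ∀ i, Module R (F i))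
    (d : ∀ i, F (i + 1) →ₗ[R] F i) (ε : F 0 →ₗ[R] M),
    (∀ i, IsFlat R (F i)) ∧
    (∀ i, n < i → Subsingleton (F i)) ∧
    (∀ i, Function.Exact (d (i + 1)) (d i)) ∧
    Function.Exact (d 0) ε ∧
    Function.Surjective ε

/-- The flat dimension of the left `R`-module `M`, with value `⊤` if there is no finite flat
resolution. -/
noncomputable def flatDim (R : Type u) [Ring R] (M : Type u) [AddCommGroup M] [Module R M] : ℕ∞ :=
  ⨅ (n : ℕ) (_ : HasFlatDimLE R M n), (n : ℕ∞)

/-- The weak dimension of `R`: the supremum of the flat dimensions of all left `R`-modules. -/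
noncomputable def weakDim (R : Type u) [Ring R] : ℕ∞ :=
  ⨆ M : ModuleCat.{u} R, flatDim R M

/-- `R` is right coherent: every finitely generated right ideal is finitely presented as a right
`R`-module. -/
def IsRightCoherent (R : Type u) [Ring R] : Prop :=
  ∀ I : Submodule Rᵐᵒᵖ R, I.FG → Module.FinitePresentation Rᵐᵒᵖ I

end GFRing

/-! The central idempotent `e = (1, 0)` of `Γ = R × S` splits every `Γ`-module as `M = eM ⊕ (1 -
e)M`. Restriction along the projection (`Res`) and cutting by the idempotent (`Corner`) are exact
and adjoint on both sides. They preserve flat modules and injectives and are compatible with tensor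
products, so they preserve Gorenstein flatness in both directions (`isGorensteinFlat_res`,
`isGorensteinFlat_corner`). An extension over `Γ` is thus the sum of one over `R` and one over `S`.
Cutting flat resolutions and finite presentations down to a factor gives the claims on weak
dimension and coherence.

For existence, take `k[ε]` with `k` of characteristic 2. Every module is an image in a periodic
complex of modules `k[ε] ⊗ M`, and injectives are flat, so every module is Gorenstein flat. Modules
of finite flat dimension satisfy `ker ε ⊆ im ε`, which fails for `k`.

For a non-coherent ring, take pairs of an integer `n` and a sequence in `𝔽₂` eventually equal to `n`
mod 2. This ring is Bézout and its annihilators have local units. Flatness is then an elementwise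
condition inherited by submodules and extensions, so Gorenstein flat modules are flat. The
annihilator of `(2, 0)` is the ideal of finitely supported sequences, which is not finitely
generated. -/

namespace GFRing

/-! ### Balanced tensor products and flatness -/

section TensorAPI

variable {R : Type u} [Ring R]
variable {M M' M'' N N' N'' : Type u}
  [AddCommGroup M] [Module Rᵐᵒᵖ M] [AddCommGroup M'] [Module Rᵐᵒᵖ M']
  [AddCommGroup M''] [Module Rᵐᵒᵖ M'']
  [AddCommGroup N] [Module R N] [AddCommGroup N'] [Module R N']
  [AddCommGroup N''] [Module R N'']

/-- The pure tensor `m ⊗ n` in `M ⊗_R N`. -/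
def Tensor.tmul (R : Type u) [Ring R] {M N : Type u} [AddCommGroup M] [Module Rᵐᵒᵖ M]
    [AddCommGroup N] [Module R N] (m : M) (n : N) : Tensor R M N :=
  QuotientAddGroup.mk (m ⊗ₜ[ℤ] n)

theorem Tensor.smul_tmul (m : M) (r : R) (n : N) :
    Tensor.tmul R (MulOpposite.op r • m) n = Tensor.tmul R m (r • n) := by
  refine (QuotientAddGroup.eq_iff_sub_mem).2 (AddSubgroup.subset_closure ⟨m, r, n, rfl⟩)

@[simp]
theorem Tensor.map_tmul (f : M →ₗ[Rᵐᵒᵖ] M') (g : N →ₗ[R] N') (m : M) (n : N) :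
    Tensor.map f g (Tensor.tmul R m n) = Tensor.tmul R (f m) (g n) := rfl

theorem Tensor.hom_ext {P : Type*} [AddCommGroup P] {f g : Tensor R M N →+ P}
    (h : ∀ m n, f (Tensor.tmul R m n) = g (Tensor.tmul R m n)) : f = g := by
  refine QuotientAddGroup.addMonoidHom_ext _ ?_
  ext x
  induction x using TensorProduct.induction_on with
  | zero => simp
  | tmul m n => exact h m n
  | add x y hx hy => rw [map_add, map_add, hx, hy]

/-- The homomorphism on `M ⊗_R N` induced by a balanced biadditive map. -/
def Tensor.lift {P : Type*} [AddCommGroup P] (f : M →+ N →+ P)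
    (hf : ∀ m (r : R) n, f (MulOpposite.op r • m) n = f m (r • n)) : Tensor R M N →+ P :=
  QuotientAddGroup.lift _ (TensorProduct.liftAddHom f (fun z m n => by simp)) (by
    unfold balancedRel
    rw [AddSubgroup.closure_le]
    rintro _ ⟨m, r, n, rfl⟩
    simp [hf])

@[simp]
theorem Tensor.lift_tmul {P : Type*} [AddCommGroup P] (f : M →+ N →+ P)
    (hf : ∀ m (r : R) n, f (MulOpposite.op r • m) n = f m (r • n)) (m : M) (n : N) :
    Tensor.lift f hf (Tensor.tmul R m n) = f m n := rfl

theorem Tensor.add_tmul (m m' : M) (n : N) :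
    Tensor.tmul R (m + m') n = Tensor.tmul R m n + Tensor.tmul R m' n :=
  congrArg (QuotientAddGroup.mk (s := balancedRel R M N)) (TensorProduct.add_tmul m m' n)

theorem Tensor.tmul_add (m : M) (n n' : N) :
    Tensor.tmul R m (n + n') = Tensor.tmul R m n + Tensor.tmul R m n' :=
  congrArg (QuotientAddGroup.mk (s := balancedRel R M N)) (TensorProduct.tmul_add m n n')

/-- The biadditive map `(m, n) ↦ m ⊗ n`. -/
def Tensor.mkHom (R M N : Type u) [Ring R] [AddCommGroup M] [Module Rᵐᵒᵖ M]
    [AddCommGroup N] [Module R N] : M →+ N →+ Tensor R M N :=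
  AddMonoidHom.mk' (fun m => AddMonoidHom.mk' (fun n => Tensor.tmul R m n) (Tensor.tmul_add m))
    (fun m m' => by ext n; exact Tensor.add_tmul m m' n)

@[simp]
theorem Tensor.mkHom_apply (m : M) (n : N) : Tensor.mkHom R M N m n = Tensor.tmul R m n := rfl

theorem Tensor.map_map (f : M →ₗ[Rᵐᵒᵖ] M') (f' : M' →ₗ[Rᵐᵒᵖ] M'') (g : N →ₗ[R] N')
    (g' : N' →ₗ[R] N'') (x : Tensor R M N) :
    Tensor.map f' g' (Tensor.map f g x) = Tensor.map (f'.comp f) (g'.comp g) x := by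
  have : (Tensor.map f' g').comp (Tensor.map f g) = Tensor.map (f'.comp f) (g'.comp g) :=
    Tensor.hom_ext fun m n => rfl
  exact DFunLike.congr_fun this x

@[simp]
theorem Tensor.map_id (x : Tensor R M N) :
    Tensor.map (LinearMap.id : M →ₗ[Rᵐᵒᵖ] M) (LinearMap.id : N →ₗ[R] N) x = x := by
  have : Tensor.map (LinearMap.id : M →ₗ[Rᵐᵒᵖ] M) (LinearMap.id : N →ₗ[R] N) =
      AddMonoidHom.id _ := Tensor.hom_ext fun m n => rfl
  exact DFunLike.congr_fun this x

theorem Tensor.map_add_right (f : M →ₗ[Rᵐᵒᵖ] M') (g g' : N →ₗ[R] N') (x : Tensor R M N) :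
    Tensor.map f (g + g') x = Tensor.map f g x + Tensor.map f g' x := by
  have : Tensor.map f (g + g') = Tensor.map f g + Tensor.map f g' :=
    Tensor.hom_ext fun m n => Tensor.tmul_add _ _ _
  exact DFunLike.congr_fun this x

theorem Tensor.map_zero_right (f : M →ₗ[Rᵐᵒᵖ] M') (x : Tensor R M N) :
    Tensor.map f (0 : N →ₗ[R] N') x = 0 := by
  have h := Tensor.map_add_right f (0 : N →ₗ[R] N') 0 x
  rw [add_zero] at h
  exact left_eq_add.1 h

/-- Left flatness passes to retracts. -/
theorem IsFlat.of_retract (h : IsFlat R N) (i : N' →ₗ[R] N) (r : N →ₗ[R] N')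
    (hri : r.comp i = LinearMap.id) : IsFlat R N' := by
  intro X Y _ _ _ _ f hf
  have hi : Function.Injective (Tensor.map (LinearMap.id : X →ₗ[Rᵐᵒᵖ] X) i) := by
    apply Function.LeftInverse.injective (g := Tensor.map LinearMap.id r)
    intro x
    rw [Tensor.map_map, hri]
    exact Tensor.map_id x
  have hc := (h X Y f hf).comp hi
  -- By naturality, `f ⊗ N'` followed by `Y ⊗ i` is `X ⊗ i` followed by `f ⊗ N`.
  refine Function.Injective.of_comp (f := Tensor.map (LinearMap.id : Y →ₗ[Rᵐᵒᵖ] Y) i) ?_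
  convert hc using 1
  ext x
  simp only [Function.comp, Tensor.map_map]
  rfl

theorem Tensor.eq_inl_add_inr (x : Tensor R M (N × N')) :
    x = Tensor.map LinearMap.id (LinearMap.inl R N N')
      (Tensor.map LinearMap.id (LinearMap.fst R N N') x) +
      Tensor.map LinearMap.id (LinearMap.inr R N N')
      (Tensor.map LinearMap.id (LinearMap.snd R N N') x) := by
  rw [Tensor.map_map, Tensor.map_map, LinearMap.comp_id, ← Tensor.map_add_right]
  rw [show LinearMap.inl R N N' ∘ₗ LinearMap.fst R N N' +
    LinearMap.inr R N N' ∘ₗ LinearMap.snd R N N' = LinearMap.id by ext <;> simp]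
  exact (Tensor.map_id x).symm

theorem IsFlat.prod (h : IsFlat R N) (h' : IsFlat R N') : IsFlat R (N × N') := by
  intro X Y _ _ _ _ f hf
  rw [injective_iff_map_eq_zero]
  intro x hx
  have h1 : Tensor.map LinearMap.id (LinearMap.fst R N N') x = 0 := by
    apply (injective_iff_map_eq_zero _).1 (h X Y f hf)
    have := congrArg (Tensor.map LinearMap.id (LinearMap.fst R N N')) hx
    rw [Tensor.map_map, map_zero] at this
    rw [Tensor.map_map]
    exact this
  have h2 : Tensor.map LinearMap.id (LinearMap.snd R N N') x = 0 := by
    apply (injective_iff_map_eq_zero _).1 (h' X Y f hf)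
    have := congrArg (Tensor.map LinearMap.id (LinearMap.snd R N N')) hx
    rw [Tensor.map_map, map_zero] at this
    rw [Tensor.map_map]
    exact this
  rw [Tensor.eq_inl_add_inr x, h1, h2, map_zero, map_zero, add_zero]

end TensorAPI

/-! ### Exactness under retracts -/

section Exact

/-- Exactness at a retract of an exact sequence of abelian groups. -/
theorem exact_of_retract {A B C A' B' C' : Type*} [AddCommGroup A] [AddCommGroup B]
    [AddCommGroup C] [AddCommGroup A'] [AddCommGroup B'] [AddCommGroup C']
    {f : A →+ B} {g : B →+ C} {f' : A' →+ B'} {g' : B' →+ C'} (h : Function.Exact f g)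
    (rA : A →+ A') (iB : B' →+ B) (rB : B →+ B') (iC : C' →+ C) (rC : C →+ C')
    (hB : ∀ b, rB (iB b) = b)
    (hf : ∀ a, rB (f a) = f' (rA a)) (hg : ∀ b, iC (g' b) = g (iB b))
    (hg' : ∀ b, rC (g b) = g' (rB b)) (hrA : Function.Surjective rA) :
    Function.Exact f' g' := by
  intro b
  constructor
  · intro hb
    have h0 : g (iB b) = 0 := by rw [← hg, hb, map_zero]
    obtain ⟨a, ha⟩ := (h _).1 h0
    exact ⟨rA a, by rw [← hf, ha, hB]⟩
  · rintro ⟨a, rfl⟩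
    obtain ⟨a, rfl⟩ := hrA a
    rw [← hf, ← hg', (h _).2 ⟨a, rfl⟩, map_zero]

end Exact

/-! ### Finite sums of Gorenstein flat modules -/

section GorensteinFlat

variable {R : Type u} [Ring R] {M N : Type u} [AddCommGroup M] [Module R M]
  [AddCommGroup N] [Module R N]

theorem IsGorensteinFlat.of_equiv (h : IsGorensteinFlat R M) (e : N ≃ₗ[R] M) :
    IsGorensteinFlat R N := by
  obtain ⟨F, i1, i2, d, h1, h2, ⟨h3⟩, h4⟩ := h
  exact ⟨F, i1, i2, d, h1, h2, ⟨e.trans h3⟩, h4⟩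

theorem tensor_exact_prod {I : Type u} [AddCommGroup I] [Module Rᵐᵒᵖ I]
    {A B C A' B' C' : Type u} [AddCommGroup A] [AddCommGroup B]
    [AddCommGroup C] [AddCommGroup A'] [AddCommGroup B'] [AddCommGroup C']
    [Module R A] [Module R B] [Module R C] [Module R A'] [Module R B'] [Module R C']
    {f : A →ₗ[R] B} {g : B →ₗ[R] C} {f' : A' →ₗ[R] B'} {g' : B' →ₗ[R] C'}
    (h : Function.Exact (Tensor.map (LinearMap.id : I →ₗ[Rᵐᵒᵖ] I) f)
      (Tensor.map (LinearMap.id : I →ₗ[Rᵐᵒᵖ] I) g))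
    (h' : Function.Exact (Tensor.map (LinearMap.id : I →ₗ[Rᵐᵒᵖ] I) f')
      (Tensor.map (LinearMap.id : I →ₗ[Rᵐᵒᵖ] I) g')) :
    Function.Exact (Tensor.map (LinearMap.id : I →ₗ[Rᵐᵒᵖ] I) (f.prodMap f'))
      (Tensor.map (LinearMap.id : I →ₗ[Rᵐᵒᵖ] I) (g.prodMap g')) := by
  intro x
  constructor
  · intro hx
    have h1 := congrArg (Tensor.map LinearMap.id (LinearMap.fst R C C')) hx
    rw [Tensor.map_map, map_zero] at h1
    have h2 := congrArg (Tensor.map LinearMap.id (LinearMap.snd R C C')) hx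
    rw [Tensor.map_map, map_zero] at h2
    obtain ⟨a, ha⟩ := (h (Tensor.map LinearMap.id (LinearMap.fst R B B') x)).1 (by
      rw [Tensor.map_map]; exact h1)
    obtain ⟨b, hb⟩ := (h' (Tensor.map LinearMap.id (LinearMap.snd R B B') x)).1 (by
      rw [Tensor.map_map]; exact h2)
    refine ⟨Tensor.map LinearMap.id (LinearMap.inl R A A') a +
      Tensor.map LinearMap.id (LinearMap.inr R A A') b, ?_⟩
    rw [Tensor.eq_inl_add_inr x, ← ha, ← hb, map_add]
    simp only [Tensor.map_map]
    congr 2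
    · congr 1; ext <;> simp
    · congr 1; ext <;> simp
  · rintro ⟨y, rfl⟩
    rw [Tensor.eq_inl_add_inr (Tensor.map _ _ _)]
    have h1 := (h (Tensor.map LinearMap.id f (Tensor.map LinearMap.id
      (LinearMap.fst R A A') y))).2 ⟨_, rfl⟩
    have h2 := (h' (Tensor.map LinearMap.id f' (Tensor.map LinearMap.id
      (LinearMap.snd R A A') y))).2 ⟨_, rfl⟩
    simp only [Tensor.map_map] at h1 h2
    have e1 : Tensor.map LinearMap.id (LinearMap.fst R C C')
        (Tensor.map (LinearMap.id : I →ₗ[Rᵐᵒᵖ] I) (g.prodMap g')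
          (Tensor.map LinearMap.id (f.prodMap f') y)) = 0 := by
      rw [Tensor.map_map, Tensor.map_map]; exact h1
    have e2 : Tensor.map LinearMap.id (LinearMap.snd R C C')
        (Tensor.map (LinearMap.id : I →ₗ[Rᵐᵒᵖ] I) (g.prodMap g')
          (Tensor.map LinearMap.id (f.prodMap f') y)) = 0 := by
      rw [Tensor.map_map, Tensor.map_map]; exact h2
    rw [e1, e2, map_zero, map_zero, add_zero]

theorem IsGorensteinFlat.prod (hM : IsGorensteinFlat R M) (hN : IsGorensteinFlat R N) :
    IsGorensteinFlat R (M × N) := by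
  obtain ⟨F, _, _, d, h1, h2, ⟨h3⟩, h4⟩ := hM
  obtain ⟨F', _, _, d', h1', h2', ⟨h3'⟩, h4'⟩ := hN
  refine ⟨fun i => F i × F' i, fun i => inferInstance, fun i => inferInstance,
    fun i => (d i).prodMap (d' i), fun i => (h1 i).prod (h1' i), fun i => ?_, ⟨?_⟩,
    fun I _ _ hI i => tensor_exact_prod (h4 I hI i) (h4' I hI i)⟩
  · rintro ⟨a, b⟩
    constructor
    · intro h
      obtain ⟨x, hx⟩ := (h2 i a).1 (congrArg Prod.fst h)
      obtain ⟨y, hy⟩ := (h2' i b).1 (congrArg Prod.snd h)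
      exact ⟨(x, y), Prod.ext hx hy⟩
    · rintro ⟨⟨x, y⟩, h⟩
      exact Prod.ext ((h2 i a).2 ⟨x, congrArg Prod.fst h⟩)
        ((h2' i b).2 ⟨y, congrArg Prod.snd h⟩)
  · refine LinearEquiv.ofBijective
      (((LinearMap.range (d 0)).subtype.comp h3.toLinearMap).prodMap
        ((LinearMap.range (d' 0)).subtype.comp h3'.toLinearMap) |>.codRestrict _ ?_) ⟨?_, ?_⟩
    · rintro ⟨m, n⟩
      obtain ⟨x, hx⟩ := (h3 m).2
      obtain ⟨y, hy⟩ := (h3' n).2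
      exact ⟨(x, y), Prod.ext hx hy⟩
    · rintro ⟨m, n⟩ ⟨m', n'⟩ h
      have h := congrArg Subtype.val h
      exact Prod.ext (h3.injective (Subtype.ext (congrArg Prod.fst h)))
        (h3'.injective (Subtype.ext (congrArg Prod.snd h)))
    · rintro ⟨_, ⟨x, y⟩, rfl⟩
      refine ⟨(h3.symm ⟨d 0 x, x, rfl⟩, h3'.symm ⟨d' 0 y, y, rfl⟩), Subtype.ext ?_⟩
      simp [LinearMap.prodMap_apply]

end GorensteinFlat

/-! ### Direct factors of rings: restriction and corners -/

/-- Data exhibiting the ring `R` as a direct factor of the ring `Γ`: a projection and a non-unital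
section whose image is cut out by the central idempotent `sect 1`. -/
structure RingFactor (Γ R : Type u) [Ring Γ] [Ring R] where
  /-- The projection onto the factor. -/
  proj : Γ →+* R
  /-- The inclusion of the factor. -/
  sect : R →ₙ+* Γ
  proj_sect : ∀ r, proj (sect r) = r
  sect_proj : ∀ g, sect (proj g) = sect 1 * g
  sect_proj' : ∀ g, sect (proj g) = g * sect 1

namespace RingFactor

/-- The first factor of a product of rings. -/
def fst (R S : Type u) [Ring R] [Ring S] : RingFactor (R × S) R where
  proj := RingHom.fst R S
  sect := { toFun := fun r => (r, 0), map_mul' := by simp, map_zero' := rfl, map_add' := by simp }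
  proj_sect _ := rfl
  sect_proj _ := Prod.ext (one_mul _).symm (zero_mul _).symm
  sect_proj' _ := Prod.ext (mul_one _).symm (mul_zero _).symm

/-- The second factor of a product of rings. -/
def snd (R S : Type u) [Ring R] [Ring S] : RingFactor (R × S) S where
  proj := RingHom.snd R S
  sect := { toFun := fun s => (0, s), map_mul' := by simp, map_zero' := rfl, map_add' := by simp }
  proj_sect _ := rfl
  sect_proj _ := Prod.ext (zero_mul _).symm (one_mul _).symm
  sect_proj' _ := Prod.ext (mul_zero _).symm (mul_one _).symm

section Basic

variable {Γ R : Type u} [Ring Γ] [Ring R] (p : RingFactor Γ R)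

/-- The opposite of a direct factor. -/
def op : RingFactor Γᵐᵒᵖ Rᵐᵒᵖ where
  proj := p.proj.op
  sect :=
    { toFun := fun r => MulOpposite.op (p.sect r.unop)
      map_mul' := by intro x y; simp
      map_zero' := by simp
      map_add' := by intro x y; simp }
  proj_sect r := congrArg MulOpposite.op (p.proj_sect r.unop)
  sect_proj g := congrArg MulOpposite.op (p.sect_proj' g.unop)
  sect_proj' g := congrArg MulOpposite.op (p.sect_proj g.unop)

theorem proj_surjective : Function.Surjective p.proj := fun r => ⟨_, p.proj_sect r⟩

theorem sect_one_mul_sect (r : R) : p.sect 1 * p.sect r = p.sect r := by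
  rw [← map_mul, one_mul]

/-- An `R`-module viewed as a `Γ`-module along the projection. -/
def Res (_ : RingFactor Γ R) (A : Type u) : Type u := A

variable (A B : Type u) [AddCommGroup A] [Module R A] [AddCommGroup B] [Module R B]

instance : AddCommGroup (p.Res A) := inferInstanceAs (AddCommGroup A)

instance : Module Γ (p.Res A) := Module.compHom A p.proj

/-- The identity map from `A` to its restriction. -/
def toRes : A ≃+ p.Res A := AddEquiv.refl A

variable {A B}

theorem smul_toRes (g : Γ) (a : A) : g • p.toRes A a = p.toRes A (p.proj g • a) := rfl

theorem toRes_symm_smul (g : Γ) (a : p.Res A) :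
    (p.toRes A).symm (g • a) = p.proj g • (p.toRes A).symm a := rfl

/-- Restriction of an `R`-linear map. -/
def resMap (f : A →ₗ[R] B) : p.Res A →ₗ[Γ] p.Res B where
  toFun a := p.toRes B (f ((p.toRes A).symm a))
  map_add' a b := by simp
  map_smul' g a := by
    rw [toRes_symm_smul, map_smul, ← smul_toRes, RingHom.id_apply]

@[simp]
theorem resMap_apply (f : A →ₗ[R] B) (a : p.Res A) :
    p.resMap f a = p.toRes B (f ((p.toRes A).symm a)) := rfl

/-- A `Γ`-linear map between restrictions is `R`-linear. -/
def unResMap (f : p.Res A →ₗ[Γ] p.Res B) : A →ₗ[R] B where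
  toFun a := (p.toRes B).symm (f (p.toRes A a))
  map_add' a b := by simp
  map_smul' r a := by
    rw [← p.proj_sect r, ← smul_toRes, map_smul, toRes_symm_smul, RingHom.id_apply]

@[simp]
theorem unResMap_apply (f : p.Res A →ₗ[Γ] p.Res B) (a : A) :
    p.unResMap f a = (p.toRes B).symm (f (p.toRes A a)) := rfl

variable (M N : Type u) [AddCommGroup M] [Module Γ M] [AddCommGroup N] [Module Γ N]

/-- The summand `e M` of a `Γ`-module `M`, where `e = sect 1`. -/
def Corner : AddSubgroup M where
  carrier := {m | p.sect 1 • m = m}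
  zero_mem' := smul_zero _
  add_mem' ha hb := by
    simp only [Set.mem_ofPred_eq] at *
    rw [smul_add, ha, hb]
  neg_mem' ha := by
    simp only [Set.mem_ofPred_eq] at *
    rw [smul_neg, ha]

variable {M N}

theorem mem_corner {m : M} : m ∈ p.Corner M ↔ p.sect 1 • m = m := Iff.rfl

theorem sect_smul_mem (r : R) (m : M) : p.sect r • m ∈ p.Corner M := by
  rw [mem_corner, smul_smul, sect_one_mul_sect]

instance : SMul R (p.Corner M) := ⟨fun r m => ⟨p.sect r • (m : M), p.sect_smul_mem r (m : M)⟩⟩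

@[simp]
theorem coe_corner_smul (r : R) (m : p.Corner M) :
    ((r • m : p.Corner M) : M) = p.sect r • (m : M) := rfl

instance : Module R (p.Corner M) where
  one_smul m := Subtype.ext m.2
  mul_smul r s m := Subtype.ext (by simp [mul_smul])
  smul_zero r := Subtype.ext (by simp)
  smul_add r m n := Subtype.ext (by simp)
  add_smul r s m := Subtype.ext (by simp [add_smul])
  zero_smul m := Subtype.ext (by simp)

/-- On `eM` the element `g` acts as `g e`, which lies in the image of `sect`. -/
theorem smul_mem_corner (g : Γ) {m : M} (hm : m ∈ p.Corner M) :
    g • m = p.sect (p.proj g) • m := by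
  rw [sect_proj', mul_smul, (p.mem_corner).1 hm]

/-- The restriction of a `Γ`-linear map to the summands `e M → e N`. -/
def cornerMap (f : M →ₗ[Γ] N) : p.Corner M →ₗ[R] p.Corner N where
  toFun m := ⟨f m, by rw [mem_corner, ← map_smul, (p.mem_corner).1 m.2]⟩
  map_add' a b := Subtype.ext (by simp)
  map_smul' r m := Subtype.ext (by simp)

@[simp]
theorem coe_cornerMap (f : M →ₗ[Γ] N) (m : p.Corner M) : (p.cornerMap f m : N) = f m := rfl

variable (M)

/-- The inclusion of `e M` into `M`. -/
def incl : p.Res (p.Corner M) →ₗ[Γ] M where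
  toFun m := ((p.toRes _).symm m : p.Corner M)
  map_add' a b := by simp
  map_smul' g m := by
    rw [toRes_symm_smul, coe_corner_smul, RingHom.id_apply, ← smul_mem_corner _ _ (Subtype.prop _)]

/-- The projection of `M` onto `e M`. -/
def retr : M →ₗ[Γ] p.Res (p.Corner M) where
  toFun m := p.toRes _ ⟨p.sect 1 • m, p.sect_smul_mem 1 m⟩
  map_add' a b := by
    rw [← map_add]
    exact congrArg _ (Subtype.ext (by simp))
  map_smul' g m := by
    rw [RingHom.id_apply, smul_toRes]
    refine congrArg _ (Subtype.ext ?_)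
    change p.sect 1 • g • m = p.sect (p.proj g) • p.sect 1 • m
    rw [smul_smul, smul_smul, ← map_mul, mul_one, p.sect_proj]

theorem incl_injective : Function.Injective (p.incl M) := fun _ _ h =>
  (p.toRes _).symm.injective (Subtype.ext h)

@[simp]
theorem incl_retr (m : M) : p.incl M (p.retr M m) = p.sect 1 • m := rfl

@[simp]
theorem retr_comp_incl : (p.retr M).comp (p.incl M) = LinearMap.id := by
  ext m
  apply p.incl_injective
  rw [LinearMap.comp_apply, incl_retr]
  exact (p.mem_corner).1 (Subtype.prop ((p.toRes _).symm m : p.Corner M))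

theorem retr_incl (m : p.Res (p.Corner M)) : p.retr M (p.incl M m) = m :=
  LinearMap.congr_fun (p.retr_comp_incl M) m

variable {M}

theorem incl_comp_resMap (f : M →ₗ[Γ] N) :
    (p.incl N).comp (p.resMap (p.cornerMap f)) = f.comp (p.incl M) := rfl

theorem resMap_comp_retr (f : M →ₗ[Γ] N) :
    (p.resMap (p.cornerMap f)).comp (p.retr M) = (p.retr N).comp f := by
  ext m
  apply p.incl_injective
  change f (p.sect 1 • m) = p.sect 1 • f m
  rw [map_smul]

/-- A preimage `x` of an element fixed by `e` can be replaced by `e x`. -/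
theorem cornerMap_exact {L : Type u} [AddCommGroup L] [Module Γ L] {f : L →ₗ[Γ] M}
    {g : M →ₗ[Γ] N} (h : Function.Exact f g) :
    Function.Exact (p.cornerMap f) (p.cornerMap g) := by
  intro m
  constructor
  · intro hm
    obtain ⟨x, hx⟩ := (h m).1 (congrArg Subtype.val hm)
    refine ⟨⟨p.sect 1 • x, p.sect_smul_mem 1 x⟩, Subtype.ext ?_⟩
    rw [coe_cornerMap, map_smul, hx]
    exact m.2
  · rintro ⟨x, rfl⟩
    exact Subtype.ext ((h _).2 ⟨x, rfl⟩)

theorem cornerMap_injective {f : M →ₗ[Γ] N} (h : Function.Injective f) :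
    Function.Injective (p.cornerMap f) := fun _ _ hab =>
  Subtype.ext (h (congrArg Subtype.val hab))

theorem cornerMap_surjective {f : M →ₗ[Γ] N} (h : Function.Surjective f) :
    Function.Surjective (p.cornerMap f) := by
  intro n
  obtain ⟨m, hm⟩ := h n
  refine ⟨⟨p.sect 1 • m, p.sect_smul_mem 1 m⟩, Subtype.ext ?_⟩
  rw [coe_cornerMap, map_smul, hm]
  exact n.2

/-- `e (Res A) = A`. -/
def cornerRes (A : Type u) [AddCommGroup A] [Module R A] : p.Corner (p.Res A) ≃ₗ[R] A where
  toFun a := (p.toRes A).symm a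
  invFun a := ⟨p.toRes A a, by rw [mem_corner, smul_toRes, p.proj_sect, one_smul]⟩
  map_add' a b := by simp
  map_smul' r a := by
    rw [coe_corner_smul, toRes_symm_smul, p.proj_sect, RingHom.id_apply]
  left_inv a := Subtype.ext (by simp)
  right_inv a := by simp

end Basic

/-! ### Transfer of flatness, injectivity and Gorenstein flatness -/

section Tensor

variable {Γ R : Type u} [Ring Γ] [Ring R] (p : RingFactor Γ R)
  (X A : Type u) [AddCommGroup X] [Module Rᵐᵒᵖ X] [AddCommGroup A] [Module R A]

/-- Tensor products of `R`-modules may be computed over `Γ`. -/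
def tensorRes : Tensor Γ (p.op.Res X) (p.Res A) ≃+ Tensor R X A :=
  AddMonoidHom.toAddEquiv
    (Tensor.lift (((Tensor.mkHom R X A).compl₂ (p.toRes A).symm.toAddMonoidHom).comp
      (p.op.toRes X).symm.toAddMonoidHom) (fun m g n => by
        change Tensor.tmul R ((p.op.toRes X).symm _) ((p.toRes A).symm _) =
          Tensor.tmul R ((p.op.toRes X).symm _) ((p.toRes A).symm _)
        rw [toRes_symm_smul, toRes_symm_smul, ← Tensor.smul_tmul]
        rfl))
    (Tensor.lift (((Tensor.mkHom Γ (p.op.Res X) (p.Res A)).compl₂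
      (p.toRes A).toAddMonoidHom).comp (p.op.toRes X).toAddMonoidHom) (fun m r n => by
        -- Every scalar of `R` comes from `Γ`, so balancing over `Γ` forces balancing over `R`.
        obtain ⟨g, rfl⟩ := p.proj_surjective r
        change Tensor.tmul Γ (p.op.toRes X _) (p.toRes A _) =
          Tensor.tmul Γ (p.op.toRes X _) (p.toRes A _)
        rw [← smul_toRes, ← Tensor.smul_tmul]
        rfl))
    (Tensor.hom_ext fun _ _ => rfl) (Tensor.hom_ext fun _ _ => rfl)

variable {X A} {Y B : Type u} [AddCommGroup Y] [Module Rᵐᵒᵖ Y] [AddCommGroup B] [Module R B]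

theorem tensorRes_map (f : X →ₗ[Rᵐᵒᵖ] Y) (g : A →ₗ[R] B) (x : Tensor Γ (p.op.Res X) (p.Res A)) :
    p.tensorRes Y B (Tensor.map (p.op.resMap f) (p.resMap g) x) =
      Tensor.map f g (p.tensorRes X A x) := by
  have : (p.tensorRes Y B).toAddMonoidHom.comp (Tensor.map (p.op.resMap f) (p.resMap g)) =
      (Tensor.map f g).comp (p.tensorRes X A).toAddMonoidHom := Tensor.hom_ext fun _ _ => rfl
  exact DFunLike.congr_fun this x

theorem tensorRes_symm_map (f : X →ₗ[Rᵐᵒᵖ] Y) (g : A →ₗ[R] B) (x : Tensor R X A) :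
    (p.tensorRes Y B).symm (Tensor.map f g x) =
      Tensor.map (p.op.resMap f) (p.resMap g) ((p.tensorRes X A).symm x) := by
  rw [AddEquiv.symm_apply_eq, tensorRes_map, AddEquiv.apply_symm_apply]

theorem resMap_injective {f : A →ₗ[R] B} (h : Function.Injective f) :
    Function.Injective (p.resMap f) := h

variable {M N L : Type u} [AddCommGroup M] [Module Γ M] [AddCommGroup N] [Module Γ N]
  [AddCommGroup L] [Module Γ L]

/-- `Res (eM)` is a direct summand of `M`, and tensoring it with restricted modules over `Γ` is
tensoring `eM` over `R`. -/
theorem isFlat_corner (h : IsFlat Γ M) : IsFlat R (p.Corner M) := by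
  have h' : IsFlat Γ (p.Res (p.Corner M)) := h.of_retract _ _ (p.retr_comp_incl M)
  intro X Y _ _ _ _ f hf a b hab
  have := h' _ _ (p.op.resMap f) (p.op.resMap_injective hf)
  apply (p.tensorRes X (p.Corner M)).symm.injective
  apply this
  have e : (LinearMap.id : p.Res (p.Corner M) →ₗ[Γ] _) = p.resMap LinearMap.id := rfl
  rw [e, ← tensorRes_symm_map, ← tensorRes_symm_map, hab]

/-- Only the summand `Ze` is seen by a restricted module: `z ⊗ a = z ⊗ e a = z e ⊗ a`. -/
theorem map_id_op_incl_retr (Z : Type u) [AddCommGroup Z] [Module Γᵐᵒᵖ Z]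
    (x : Tensor Γ Z (p.Res A)) :
    Tensor.map (p.op.incl Z) LinearMap.id (Tensor.map (p.op.retr Z) LinearMap.id x) = x := by
  have : (Tensor.map (p.op.incl Z) LinearMap.id).comp (Tensor.map (p.op.retr Z) LinearMap.id) =
      AddMonoidHom.id (Tensor Γ Z (p.Res A)) := by
    refine Tensor.hom_ext fun z a => ?_
    change Tensor.tmul Γ (p.op.incl Z (p.op.retr Z z)) a = Tensor.tmul Γ z a
    rw [incl_retr]
    change Tensor.tmul Γ (MulOpposite.op (p.sect 1) • z) a = Tensor.tmul Γ z a
    rw [Tensor.smul_tmul]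
    congr 1
    apply (p.toRes A).symm.injective
    rw [toRes_symm_smul, p.proj_sect, one_smul]
  exact DFunLike.congr_fun this x

/-- Naturally in `X`, `X ⊗ Res A` over `Γ` is `Xe ⊗ A` over `R`, and `X ↦ Xe` preserves injections.
-/
theorem isFlat_res (h : IsFlat R A) : IsFlat Γ (p.Res A) := by
  intro X Y _ _ _ _ f hf a b hab
  have h1 := h _ _ (p.op.cornerMap f) (p.op.cornerMap_injective hf)
  have h2 : Function.Injective (Tensor.map (p.op.resMap (p.op.cornerMap f))
      (LinearMap.id : p.Res A →ₗ[Γ] _)) := by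
    intro x y hxy
    apply (p.tensorRes _ A).injective
    apply h1
    rw [← tensorRes_map, ← tensorRes_map]
    exact congrArg _ hxy
  rw [← p.map_id_op_incl_retr X a, ← p.map_id_op_incl_retr X b]
  congr 1
  apply h2
  rw [Tensor.map_map, Tensor.map_map, resMap_comp_retr]
  have := congrArg (Tensor.map (p.op.retr Y) LinearMap.id) hab
  rw [Tensor.map_map, Tensor.map_map] at this
  exact this

/-- `Res` is right adjoint to `Corner`, which preserves injections. -/
theorem injective_res (h : Module.Injective R A) : Module.Injective Γ (p.Res A) := by
  refine ⟨fun X Y _ _ _ _ f hf g => ?_⟩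
  obtain ⟨h', hh⟩ := h.out (p.cornerMap f) (p.cornerMap_injective hf)
    ((p.cornerRes A).toLinearMap.comp (p.cornerMap g))
  refine ⟨(p.resMap h').comp (p.retr Y), fun x => ?_⟩
  apply (p.toRes A).symm.injective
  have e1 := hh ((p.toRes _).symm (p.retr X x))
  have e2 : p.retr Y (f x) = p.resMap (p.cornerMap f) (p.retr X x) :=
    (LinearMap.congr_fun (p.resMap_comp_retr f) x).symm
  rw [LinearMap.comp_apply, e2]
  refine e1.trans ?_
  change (p.toRes A).symm (g (p.sect 1 • x)) = _
  rw [map_smul, toRes_symm_smul, p.proj_sect, one_smul]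

/-- `Corner` is also right adjoint to `Res`, which preserves injections. -/
theorem injective_corner (h : Module.Injective Γ M) : Module.Injective R (p.Corner M) := by
  refine ⟨fun X Y _ _ _ _ f hf g => ?_⟩
  obtain ⟨h', hh⟩ := h.out (p.resMap f) (p.resMap_injective hf)
    ((p.incl M).comp (p.resMap g))
  refine ⟨p.unResMap ((p.retr M).comp h'), fun x => ?_⟩
  apply (p.toRes _).injective
  rw [unResMap_apply, AddEquiv.apply_symm_apply, LinearMap.comp_apply]
  have := hh (p.toRes X x)
  simp only [resMap_apply, AddEquiv.symm_apply_apply] at this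
  rw [this, LinearMap.comp_apply, retr_incl]
  rfl

theorem resMap_exact {C : Type u} [AddCommGroup C] [Module R C] {f : A →ₗ[R] B} {g : B →ₗ[R] C}
    (h : Function.Exact f g) : Function.Exact (p.resMap f) (p.resMap g) := h

theorem isGorensteinFlat_res (h : IsGorensteinFlat R A) : IsGorensteinFlat Γ (p.Res A) := by
  obtain ⟨F, _, _, d, h1, h2, ⟨h3⟩, h4⟩ := h
  refine ⟨fun i => p.Res (F i), fun i => inferInstance, fun i => inferInstance,
    fun i => p.resMap (d i), fun i => p.isFlat_res (h1 i), fun i => p.resMap_exact (h2 i),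
    ⟨LinearEquiv.ofBijective ((p.resMap ((LinearMap.range (d 0)).subtype.comp
      h3.toLinearMap)).codRestrict _ ?_) ⟨?_, ?_⟩⟩, fun I _ _ hI i => ?_⟩
  · intro a
    obtain ⟨x, hx⟩ := (h3 ((p.toRes A).symm a)).2
    exact ⟨p.toRes _ x, congrArg (p.toRes _) hx⟩
  · intro a b hab
    exact h3.injective (Subtype.ext (congrArg Subtype.val hab))
  · rintro ⟨_, x, rfl⟩
    refine ⟨p.toRes A (h3.symm ⟨d 0 ((p.toRes _).symm x), _, rfl⟩), Subtype.ext ?_⟩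
    simp [LinearMap.codRestrict_apply]
  -- `Ie` is injective over `R`, and `I ⊗ Res F` is identified with `Ie ⊗ F`.
  · have h5 := h4 _ (p.op.injective_corner hI) i
    refine exact_of_retract h5
      ((Tensor.map (p.op.incl I) LinearMap.id).comp (p.tensorRes _ _).symm.toAddMonoidHom)
      ((p.tensorRes _ _).toAddMonoidHom.comp (Tensor.map (p.op.retr I) LinearMap.id))
      ((Tensor.map (p.op.incl I) LinearMap.id).comp (p.tensorRes _ _).symm.toAddMonoidHom)
      ((p.tensorRes _ _).toAddMonoidHom.comp (Tensor.map (p.op.retr I) LinearMap.id))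
      ((Tensor.map (p.op.incl I) LinearMap.id).comp (p.tensorRes _ _).symm.toAddMonoidHom)
      ?_ ?_ ?_ ?_ ?_
    · intro b
      simp [p.map_id_op_incl_retr]
    · intro a
      simp only [AddMonoidHom.comp_apply, AddEquiv.toAddMonoidHom_eq_coe, AddMonoidHom.coe_coe,
        tensorRes_symm_map, Tensor.map_map]
      rfl
    · intro b
      simp only [AddMonoidHom.comp_apply, AddEquiv.toAddMonoidHom_eq_coe, AddMonoidHom.coe_coe,
        Tensor.map_map]
      rw [← tensorRes_map, Tensor.map_map]
      rfl
    · intro b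
      simp only [AddMonoidHom.comp_apply, AddEquiv.toAddMonoidHom_eq_coe, AddMonoidHom.coe_coe,
        tensorRes_symm_map, Tensor.map_map]
      rfl
    · intro x
      refine ⟨p.tensorRes _ _ (Tensor.map (p.op.retr I) LinearMap.id x), ?_⟩
      simp [p.map_id_op_incl_retr]

theorem isGorensteinFlat_corner (h : IsGorensteinFlat Γ M) : IsGorensteinFlat R (p.Corner M) := by
  obtain ⟨F, _, _, d, h1, h2, ⟨h3⟩, h4⟩ := h
  refine ⟨fun i => p.Corner (F i), fun i => inferInstance, fun i => inferInstance,
    fun i => p.cornerMap (d i), fun i => p.isFlat_corner (h1 i), fun i => p.cornerMap_exact (h2 i),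
    ⟨LinearEquiv.ofBijective ((p.cornerMap ((LinearMap.range (d 0)).subtype.comp
      h3.toLinearMap)).codRestrict _ ?_) ⟨?_, ?_⟩⟩, fun I _ _ hI i => ?_⟩
  · intro a
    obtain ⟨x, hx⟩ := (h3 a).2
    refine ⟨⟨p.sect 1 • x, p.sect_smul_mem 1 x⟩, Subtype.ext ?_⟩
    rw [coe_cornerMap, map_smul, hx, coe_cornerMap]
    change p.sect 1 • ((h3 a : LinearMap.range (d 0)) : F (0 + 1)) =
      ((h3 a : LinearMap.range (d 0)) : F (0 + 1))
    rw [← Submodule.coe_smul, ← map_smul, (p.mem_corner).1 a.2]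
  · intro a b hab
    exact Subtype.ext (h3.injective (Subtype.ext (congrArg (Subtype.val ∘ Subtype.val) hab)))
  · rintro ⟨_, x, rfl⟩
    refine ⟨⟨h3.symm ⟨d 0 x, x, rfl⟩, ?_⟩, Subtype.ext (Subtype.ext ?_)⟩
    · rw [mem_corner, ← map_smul]
      refine congrArg _ (Subtype.ext ?_)
      rw [Submodule.coe_smul, ← map_smul, (p.mem_corner).1 x.2]
    · simp [LinearMap.codRestrict_apply]
  -- `Res I` is injective over `Γ`, and `I ⊗ eF` is a natural direct summand of `Res I ⊗ F`.
  · have h5 := h4 _ (p.op.injective_res hI) i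
    have key : ∀ {P Q : Type u} [AddCommGroup P] [AddCommGroup Q] [Module Γ P] [Module Γ Q]
        (f : P →ₗ[Γ] Q) (x : Tensor R I (p.Corner P)),
        (p.tensorRes I (p.Corner Q)).symm (Tensor.map LinearMap.id (p.cornerMap f) x) =
        Tensor.map LinearMap.id (p.resMap (p.cornerMap f)) ((p.tensorRes _ _).symm x) :=
      fun f x => p.tensorRes_symm_map _ _ _
    have key' : ∀ {P Q : Type u} [AddCommGroup P] [AddCommGroup Q] [Module Γ P] [Module Γ Q]
        (f : P →ₗ[Γ] Q) (x : Tensor Γ (p.op.Res I) (p.Res (p.Corner P))),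
        Tensor.map LinearMap.id (p.cornerMap f) (p.tensorRes _ _ x) =
        p.tensorRes I (p.Corner Q) (Tensor.map LinearMap.id (p.resMap (p.cornerMap f)) x) :=
      fun f x => (p.tensorRes_map _ _ _).symm
    refine exact_of_retract h5
      ((p.tensorRes _ _).toAddMonoidHom.comp (Tensor.map LinearMap.id (p.retr _)))
      ((Tensor.map LinearMap.id (p.incl _)).comp (p.tensorRes _ _).symm.toAddMonoidHom)
      ((p.tensorRes _ _).toAddMonoidHom.comp (Tensor.map LinearMap.id (p.retr _)))
      ((Tensor.map LinearMap.id (p.incl _)).comp (p.tensorRes _ _).symm.toAddMonoidHom)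
      ((p.tensorRes _ _).toAddMonoidHom.comp (Tensor.map LinearMap.id (p.retr _)))
      ?_ ?_ ?_ ?_ ?_
    · intro b
      simp [Tensor.map_map]
    · intro a
      simp only [AddMonoidHom.comp_apply, AddEquiv.toAddMonoidHom_eq_coe, AddMonoidHom.coe_coe,
        key', Tensor.map_map, resMap_comp_retr]
    · intro b
      simp only [AddMonoidHom.comp_apply, AddEquiv.toAddMonoidHom_eq_coe, AddMonoidHom.coe_coe,
        key, Tensor.map_map, incl_comp_resMap]
    · intro b
      simp only [AddMonoidHom.comp_apply, AddEquiv.toAddMonoidHom_eq_coe, AddMonoidHom.coe_coe,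
        key', Tensor.map_map, resMap_comp_retr]
    · intro x
      refine ⟨Tensor.map LinearMap.id (p.incl _) ((p.tensorRes _ _).symm x), ?_⟩
      simp [Tensor.map_map]

end Tensor

/-! ### Weak dimension of a factor -/

section WeakDim

variable {Γ R : Type u} [Ring Γ] [Ring R] (p : RingFactor Γ R)

theorem hasFlatDimLE_corner {M : Type u} [AddCommGroup M] [Module Γ M] {n : ℕ}
    (h : HasFlatDimLE Γ M n) : HasFlatDimLE R (p.Corner M) n := by
  obtain ⟨F, _, _, d, ε, h1, h2, h3, h4, h5⟩ := h
  refine ⟨fun i => p.Corner (F i), fun i => inferInstance, fun i => inferInstance,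
    fun i => p.cornerMap (d i), p.cornerMap ε, fun i => p.isFlat_corner (h1 i), fun i hi => ?_,
    fun i => p.cornerMap_exact (h3 i), p.cornerMap_exact h4, p.cornerMap_surjective h5⟩
  have := h2 i hi
  infer_instance

theorem _root_.GFRing.HasFlatDimLE.of_equiv {M N : Type u} [AddCommGroup M] [Module R M]
    [AddCommGroup N] [Module R N] {n : ℕ} (h : HasFlatDimLE R M n) (e : M ≃ₗ[R] N) :
    HasFlatDimLE R N n := by
  obtain ⟨F, _, _, d, ε, h1, h2, h3, h4, h5⟩ := h
  refine ⟨F, _, _, d, e.toLinearMap.comp ε, h1, h2, h3, fun x => ?_, e.surjective.comp h5⟩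
  rw [← h4 x]
  simp

/-- Since `M = e (Res M)`, a flat resolution of `Res M` over `Γ` cuts down to one of `M` of the same
length. -/
theorem weakDim_le (p : RingFactor Γ R) : weakDim R ≤ weakDim Γ := by
  refine iSup_le fun M => ?_
  refine le_trans ?_ (le_iSup (fun M : ModuleCat.{u} Γ => flatDim Γ M)
    (ModuleCat.of Γ (p.Res M)))
  refine le_iInf₂ fun n hn => ?_
  exact iInf₂_le n ((p.hasFlatDimLE_corner hn).of_equiv (p.cornerRes M))

end WeakDim

/-! ### Coherence of a factor -/

section Coherent

variable {Γ R : Type u} [Ring Γ] [Ring R] (p : RingFactor Γ R)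

theorem res_fg_of_fg {A : Type u} [AddCommGroup A] [Module R A] {s : Set A}
    (hs : Submodule.span R s = ⊤) : Submodule.span Γ (p.toRes A '' s) = ⊤ := by
  rw [eq_top_iff]
  rintro a -
  have ha : (p.toRes A).symm a ∈ Submodule.span R s := hs ▸ Submodule.mem_top
  suffices ∀ x ∈ Submodule.span R s, p.toRes A x ∈ Submodule.span Γ (p.toRes A '' s) from
    this _ ha
  intro x hx
  induction hx using Submodule.span_induction with
  | mem x h => exact Submodule.subset_span ⟨x, h, rfl⟩
  | zero => rw [map_zero]; exact zero_mem _
  | add x y _ _ hx hy => rw [map_add]; exact add_mem hx hy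
  | smul r x _ hx =>
    rw [← p.proj_sect r, ← smul_toRes]
    exact Submodule.smul_mem _ _ hx

/-- As `e` acts as the identity on `Res A`, a surjection `f : Γⁿ → Res A` factors through `q : Γⁿ →
Rⁿ`. The kernel of the induced map is the image of `ker f`, hence finitely generated. -/
theorem finitePresentation_of_res {A : Type u} [AddCommGroup A] [Module R A]
    (h : Module.FinitePresentation Γ (p.Res A)) : Module.FinitePresentation R A := by
  obtain ⟨n, f, hf⟩ := Module.Finite.exists_fin' Γ (p.Res A)
  have hk := Module.FinitePresentation.fg_ker f hf
  let q : (Fin n → Γ) →ₛₗ[p.proj] (Fin n → R) :=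
    { toFun := fun v i => p.proj (v i)
      map_add' := fun v w => by ext; simp
      map_smul' := fun g v => by ext; simp }
  have hq : Function.Surjective q := fun w =>
    ⟨fun i => p.sect (w i), funext fun i => p.proj_sect (w i)⟩
  let f' : (Fin n → R) →ₗ[R] A :=
    { toFun := fun w => (p.toRes A).symm (f (fun i => p.sect (w i)))
      map_add' := fun v w => by
        rw [← map_add, ← map_add]
        congr 2
        ext i; simp
      map_smul' := fun r v => by
        rw [RingHom.id_apply]
        conv_rhs => rw [← p.proj_sect r, ← toRes_symm_smul, ← map_smul]
        congr 2
        ext i; simp }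
  have hfq : ∀ v, f' (q v) = (p.toRes A).symm (f v) := by
    intro v
    change (p.toRes A).symm (f (fun i => p.sect (p.proj (v i)))) = _
    have : (fun i => p.sect (p.proj (v i))) = p.sect 1 • v := by
      ext i; simp [p.sect_proj]
    rw [this, map_smul, toRes_symm_smul, p.proj_sect, one_smul]
  have : RingHomSurjective p.proj := ⟨p.proj_surjective⟩
  refine Module.finitePresentation_of_free_of_surjective f' ?_ ?_
  · intro a
    obtain ⟨v, hv⟩ := hf (p.toRes A a)
    exact ⟨q v, by rw [hfq, hv, AddEquiv.symm_apply_apply]⟩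
  · have : LinearMap.ker f' = (LinearMap.ker f).map q := by
      ext w
      obtain ⟨v, rfl⟩ := hq w
      rw [LinearMap.mem_ker]
      constructor
      · intro h
        rw [hfq] at h
        exact ⟨v, (p.toRes A).symm.injective (h.trans (map_zero _).symm), rfl⟩
      · rintro ⟨v', hv', h'⟩
        rw [← h', hfq, show f v' = 0 from hv', map_zero]
    rw [this]
    exact hk.map q

/-- Through `sect`, a finitely generated right ideal of `R` becomes one of `Γ`. -/
theorem isRightCoherent (p : RingFactor Γ R) (h : IsRightCoherent Γ) : IsRightCoherent R := by
  intro J hJ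
  apply p.op.finitePresentation_of_res
  let i : p.op.Res J →ₗ[Γᵐᵒᵖ] Γ :=
    { toFun := fun x => p.sect (((p.op.toRes J).symm x : J) : R)
      map_add' := fun x y => by simp
      map_smul' := fun g x => by
        rw [toRes_symm_smul]
        change p.sect (((p.op.toRes J).symm x : J) * p.proj g.unop) = p.sect _ * g.unop
        rw [map_mul, p.sect_proj, ← mul_assoc, ← map_mul, mul_one] }
  have hi : Function.Injective i := by
    intro x y hxy
    apply (p.op.toRes J).symm.injective
    apply Subtype.ext
    have := congrArg p.proj hxy
    simpa [i, p.proj_sect] using this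
  have hfin : Module.Finite Γᵐᵒᵖ (p.op.Res J) := by
    obtain ⟨s, hs⟩ := (Submodule.fg_top J).2 hJ
    classical
    refine ⟨⟨s.image (p.op.toRes J), ?_⟩⟩
    rw [Finset.coe_image]
    exact p.op.res_fg_of_fg hs
  have := h (LinearMap.range i) (by
    rw [LinearMap.range_eq_map]
    exact hfin.1.map i)
  exact Module.FinitePresentation.of_equiv (LinearEquiv.ofInjective i hi).symm

end Coherent

end RingFactor

/-- A module over a product of rings is the product of its components. -/
noncomputable def prodDecomp (R S M : Type u) [Ring R] [Ring S] [AddCommGroup M]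
    [Module (R × S) M] :
    M ≃ₗ[R × S] ((RingFactor.fst R S).Res ((RingFactor.fst R S).Corner M)) ×
      ((RingFactor.snd R S).Res ((RingFactor.snd R S).Corner M)) :=
  LinearEquiv.ofLinearMap (((RingFactor.fst R S).retr M).prod ((RingFactor.snd R S).retr M))
    (((RingFactor.fst R S).incl M).coprod ((RingFactor.snd R S).incl M))
    (by
      have h1 : ∀ x, (RingFactor.snd R S).retr M ((RingFactor.fst R S).incl M x) = 0 := by
        intro x
        rw [← (RingFactor.fst R S).retr_incl M x, RingFactor.incl_retr]
        apply (RingFactor.snd R S).incl_injective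
        rw [RingFactor.incl_retr, smul_smul, map_zero]
        have : (RingFactor.snd R S).sect 1 * (RingFactor.fst R S).sect 1 = 0 :=
          Prod.ext (zero_mul _) (mul_zero _)
        rw [this, zero_smul]
      have h2 : ∀ x, (RingFactor.fst R S).retr M ((RingFactor.snd R S).incl M x) = 0 := by
        intro x
        rw [← (RingFactor.snd R S).retr_incl M x, RingFactor.incl_retr]
        apply (RingFactor.fst R S).incl_injective
        rw [RingFactor.incl_retr, smul_smul, map_zero]
        have : (RingFactor.fst R S).sect 1 * (RingFactor.snd R S).sect 1 = 0 :=
          Prod.ext (mul_zero _) (zero_mul _)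
        rw [this, zero_smul]
      ext x <;> simp [h1, h2, RingFactor.retr_incl])
    (by
      ext m
      have : (RingFactor.fst R S).sect 1 + (RingFactor.snd R S).sect 1 = 1 :=
        Prod.ext (add_zero _) (zero_add _)
      simp [← add_smul, this])

/-- Each corner of the extension is an extension of Gorenstein flat modules over its own factor;
`prodDecomp` reassembles `B`. -/
theorem IsLeftGFClosed.prod {R S : Type u} [Ring R] [Ring S] (hR : IsLeftGFClosed R)
    (hS : IsLeftGFClosed S) : IsLeftGFClosed (R × S) := by
  intro A B C _ _ _ _ _ _ f g hf hfg hg hA hC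
  have h1 (T : Type u) [Ring T] (p : RingFactor (R × S) T) (hT : IsLeftGFClosed T) :
      IsGorensteinFlat (R × S) (p.Res (p.Corner B)) :=
    p.isGorensteinFlat_res (hT _ _ _ (p.cornerMap f) (p.cornerMap g) (p.cornerMap_injective hf)
      (p.cornerMap_exact hfg) (p.cornerMap_surjective hg) (p.isGorensteinFlat_corner hA)
      (p.isGorensteinFlat_corner hC))
  exact ((h1 R (.fst R S) hR).prod (h1 S (.snd R S) hS)).of_equiv (prodDecomp R S B)

/-! ### Comparison with the commutative notions -/

section Commutative

variable {A : Type u} [CommRing A]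

/-- A right module over a commutative ring as a left module. -/
abbrev leftModule (A X : Type u) [CommRing A] [AddCommGroup X] [Module Aᵐᵒᵖ X] : Module A X :=
  Module.compHom X ((RingHom.id A).toOpposite fun _ _ => mul_comm _ _)

variable {X Y N N' : Type u} [AddCommGroup X] [Module A X] [Module Aᵐᵒᵖ X] [IsCentralScalar A X]
  [AddCommGroup Y] [Module A Y] [Module Aᵐᵒᵖ Y] [IsCentralScalar A Y]
  [AddCommGroup N] [Module A N] [AddCommGroup N'] [Module A N']

variable (X N) in
/-- Over a commutative ring, `Tensor` is the usual tensor product. -/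
def tensorEquiv : Tensor A X N ≃+ X ⊗[A] N :=
  AddMonoidHom.toAddEquiv
    (Tensor.lift (AddMonoidHom.mk' (fun x => AddMonoidHom.mk' (fun n => x ⊗ₜ[A] n)
        (TensorProduct.tmul_add x)) (fun x y => by ext n; exact TensorProduct.add_tmul x y n))
      (fun x a n => by
        rw [op_smul_eq_smul]
        exact TensorProduct.smul_tmul a x n))
    (TensorProduct.liftAddHom (Tensor.mkHom A X N) (fun a x n => by
      rw [← op_smul_eq_smul]
      exact Tensor.smul_tmul x a n))
    (Tensor.hom_ext fun _ _ => rfl)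
    (by
      ext x
      induction x using TensorProduct.induction_on with
      | zero => simp
      | tmul => rfl
      | add x y hx hy => rw [map_add, map_add, hx, hy])

theorem tensorEquiv_map (f : X →ₗ[Aᵐᵒᵖ] Y) (f' : X →ₗ[A] Y) (hf : ∀ x, f x = f' x)
    (g : N →ₗ[A] N') (x : Tensor A X N) :
    tensorEquiv Y N' (Tensor.map f g x) = TensorProduct.map f' g (tensorEquiv X N x) := by
  have : (tensorEquiv Y N').toAddMonoidHom.comp (Tensor.map f g) =
      (TensorProduct.map f' g).toAddMonoidHom.comp (tensorEquiv X N).toAddMonoidHom :=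
    Tensor.hom_ext fun x n => by
      change f x ⊗ₜ[A] g n = f' x ⊗ₜ[A] g n
      rw [hf]
  exact DFunLike.congr_fun this x

/-- A linear map of right modules over a commutative ring as a map of left modules. -/
def leftMap (f : X →ₗ[Aᵐᵒᵖ] Y) : X →ₗ[A] Y where
  toFun := f
  map_add' := map_add f
  map_smul' a x := by rw [← op_smul_eq_smul, map_smul, op_smul_eq_smul]; rfl

/-- A linear map of left modules over a commutative ring as a map of right modules. -/
def rightMap (f : X →ₗ[A] Y) : X →ₗ[Aᵐᵒᵖ] Y where
  toFun := f
  map_add' := map_add f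
  map_smul' a x := by
    induction a with | _ a => rw [op_smul_eq_smul, map_smul, ← op_smul_eq_smul]; rfl

theorem isFlat_of_flat (h : Module.Flat A N) : IsFlat A N := by
  intro X Y _ _ _ _ f hf
  let _ := leftModule A X
  let _ := leftModule A Y
  have : IsCentralScalar A X := ⟨fun _ _ => rfl⟩
  have : IsCentralScalar A Y := ⟨fun _ _ => rfl⟩
  have h1 := Module.Flat.rTensor_preserves_injective_linearMap (M := N) (leftMap f) hf
  intro a b hab
  apply (tensorEquiv X N).injective
  apply h1
  have := congrArg (tensorEquiv Y N) hab
  rwa [tensorEquiv_map f (leftMap f) (fun _ => rfl),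
    tensorEquiv_map f (leftMap f) (fun _ => rfl)] at this

theorem flat_of_isFlat (h : IsFlat A N) : Module.Flat A N := by
  rw [Module.Flat.iff_rTensor_injective']
  intro I
  have h1 := h _ _ (rightMap I.subtype) I.subtype_injective
  intro a b hab
  apply (tensorEquiv I N).symm.injective
  apply h1
  apply (tensorEquiv A N).injective
  rw [tensorEquiv_map _ I.subtype (fun _ => rfl), tensorEquiv_map _ I.subtype (fun _ => rfl),
    AddEquiv.apply_symm_apply, AddEquiv.apply_symm_apply]
  exact hab

/-- If `a x = 0` in a flat module, then `x` is a combination of elements with coefficients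
annihilating `a`. -/
theorem exists_sum_of_smul_eq_zero [Module.Flat A N] {a : A} {x : N} (h : a • x = 0) :
    ∃ (k : ℕ) (b : Fin k → A) (y : Fin k → N), x = ∑ j, b j • y j ∧ ∀ j, a * b j = 0 := by
  -- The equational criterion for flatness is applied to a relation with one term.
  have h' : ∑ i : Fin 1, (fun _ => a) i • (fun _ => x) i = 0 := by simpa using h
  obtain ⟨k, b, y, h1, h2⟩ := Module.Flat.isTrivialRelation_of_sum_smul_eq_zero h'
  refine ⟨k, b 0, y, h1 0, fun j => ?_⟩
  simpa using h2 j

end Commutative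

/-! ### Periodic resolutions -/

section ConstantComplex

variable {R : Type u} [Ring R] {M F : Type u} [AddCommGroup M] [Module R M] [AddCommGroup F]
  [Module R F]

/-- A periodic complete flat resolution witnesses Gorenstein flatness. -/
theorem isGorensteinFlat_of_periodic (d : F →ₗ[R] F) (hF : IsFlat R F)
    (hd : Function.Exact d d) (e : M ≃ₗ[R] LinearMap.range d)
    (h : ∀ (I : Type u) [AddCommGroup I] [Module Rᵐᵒᵖ I], Module.Injective Rᵐᵒᵖ I →
      Function.Exact (Tensor.map (LinearMap.id : I →ₗ[Rᵐᵒᵖ] I) d)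
        (Tensor.map (LinearMap.id : I →ₗ[Rᵐᵒᵖ] I) d)) : IsGorensteinFlat R M :=
  ⟨fun _ => F, fun _ => inferInstance, fun _ => inferInstance, fun _ => d, fun _ => hF,
    fun _ => hd, ⟨e⟩, fun I _ _ hI _ => h I hI⟩

/-- The periodic complex with `d (x, y) = (y, 0)` has the contraction `s (x, y) = (0, x)`, so it
stays exact under every tensor functor. -/
theorem IsFlat.isGorensteinFlat (h : IsFlat R M) : IsGorensteinFlat R M := by
  let d : M × M →ₗ[R] M × M := (LinearMap.inl R M M).comp (LinearMap.snd R M M)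
  let s : M × M →ₗ[R] M × M := (LinearMap.inr R M M).comp (LinearMap.fst R M M)
  have hdd : d.comp d = 0 := by ext <;> simp [d]
  have hds : d.comp s + s.comp d = LinearMap.id := by ext <;> simp [d, s]
  refine isGorensteinFlat_of_periodic d (h.prod h) (fun x => ⟨fun hx => ⟨s x, ?_⟩, ?_⟩)
    ((LinearEquiv.ofInjective _ LinearMap.inl_injective).trans
      (LinearEquiv.ofEq (LinearMap.range (LinearMap.inl R M M)) _ ?_)) (fun I _ _ _ x => ⟨fun hx =>
        ⟨Tensor.map LinearMap.id s x, ?_⟩, ?_⟩)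
  · have := LinearMap.congr_fun hds x
    simpa [hx] using this
  · rintro ⟨y, rfl⟩
    exact LinearMap.congr_fun hdd y
  · rw [LinearMap.range_comp_of_range_eq_top _ (LinearMap.range_eq_top.2 LinearMap.snd_surjective)]
  · have := Tensor.map_add_right (LinearMap.id : I →ₗ[Rᵐᵒᵖ] I) (d.comp s) (s.comp d) x
    rw [hds, Tensor.map_id, ← LinearMap.id_comp (LinearMap.id : I →ₗ[Rᵐᵒᵖ] I),
      ← Tensor.map_map, ← Tensor.map_map, hx, map_zero, add_zero] at this
    exact this.symm
  · rintro ⟨y, rfl⟩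
    rw [Tensor.map_map, hdd, Tensor.map_zero_right]

theorem tensor_exact_of_flat {A X N₁ N₂ N₃ : Type u} [CommRing A] [AddCommGroup X] [Module A X]
    [Module Aᵐᵒᵖ X] [IsCentralScalar A X] [Module.Flat A X] [AddCommGroup N₁] [Module A N₁]
    [AddCommGroup N₂] [Module A N₂] [AddCommGroup N₃] [Module A N₃] {f : N₁ →ₗ[A] N₂}
    {g : N₂ →ₗ[A] N₃} (h : Function.Exact f g) :
    Function.Exact (Tensor.map (LinearMap.id : X →ₗ[Aᵐᵒᵖ] X) f)
      (Tensor.map (LinearMap.id : X →ₗ[Aᵐᵒᵖ] X) g) := by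
  have h1 := Module.Flat.lTensor_exact X h
  have key {P Q : Type u} [AddCommGroup P] [Module A P] [AddCommGroup Q] [Module A Q]
      (f : P →ₗ[A] Q) (x : Tensor A X P) : tensorEquiv X Q (Tensor.map LinearMap.id f x) =
      f.lTensor X (tensorEquiv X P x) := tensorEquiv_map _ _ (fun _ => rfl) _ _
  intro x
  rw [← (tensorEquiv X N₃).map_eq_zero_iff, key, h1]
  constructor
  · rintro ⟨y, hy⟩
    refine ⟨(tensorEquiv X N₁).symm y, (tensorEquiv X N₂).injective ?_⟩
    rw [key, AddEquiv.apply_symm_apply, hy]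
  · rintro ⟨y, rfl⟩
    exact ⟨tensorEquiv X N₁ y, (key _ _).symm⟩

end ConstantComplex

/-! ### Dual numbers: infinite weak dimension, all modules Gorenstein flat -/

section DualNumbers

variable {k : Type u} [Field k]

/-- The condition that the kernel of `ε` on `M` is contained in its image. -/
def EpsExact (M : Type u) [AddCommGroup M] [Module (DualNumber k) M] : Prop :=
  ∀ m : M, (DualNumber.eps : DualNumber k) • m = 0 →
    ∃ m' : M, (DualNumber.eps : DualNumber k) • m' = m

theorem dvd_of_eps_mul_eq_zero {a : DualNumber k} (h : DualNumber.eps * a = 0) :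
    ∃ b, a = DualNumber.eps * b := by
  refine ⟨TrivSqZeroExt.inl (TrivSqZeroExt.snd a), ?_⟩
  have h1 := congrArg TrivSqZeroExt.snd h
  simp at h1
  ext <;> simp [h1]

/-- By the equational criterion, an element killed by `ε` is a combination with coefficients killed
by `ε`, and these are multiples of `ε`. -/
theorem EpsExact.of_isFlat {M : Type u} [AddCommGroup M] [Module (DualNumber k) M]
    (h : IsFlat (DualNumber k) M) : EpsExact (k := k) M := by
  have := flat_of_isFlat h
  intro m hm
  obtain ⟨n, b, y, rfl, hb⟩ := exists_sum_of_smul_eq_zero hm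
  choose c hc using fun j => dvd_of_eps_mul_eq_zero (hb j)
  refine ⟨∑ j, c j • y j, ?_⟩
  rw [Finset.smul_sum]
  refine Finset.sum_congr rfl fun j _ => ?_
  rw [smul_smul, ← hc]

/-- If `ε x = f y`, then `ε y = 0` because `ε² = 0`. So `y = ε z`, and `x - f z` is killed by `ε`,
hence divisible by it. -/
theorem EpsExact.of_exact {K F M : Type u} [AddCommGroup K] [AddCommGroup F] [AddCommGroup M]
    [Module (DualNumber k) K] [Module (DualNumber k) F] [Module (DualNumber k) M]
    {f : K →ₗ[DualNumber k] F} {g : F →ₗ[DualNumber k] M} (hf : Function.Injective f)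
    (hfg : Function.Exact f g) (hg : Function.Surjective g) (hK : EpsExact (k := k) K)
    (hF : EpsExact (k := k) F) : EpsExact (k := k) M := by
  intro m hm
  obtain ⟨x, rfl⟩ := hg m
  rw [← map_smul] at hm
  obtain ⟨y, hy⟩ := (hfg _).1 hm
  have h1 : (DualNumber.eps : DualNumber k) • y = 0 := by
    apply hf
    rw [map_smul, hy, smul_smul, DualNumber.eps_mul_eps, zero_smul, map_zero]
  obtain ⟨z, rfl⟩ := hK y h1
  obtain ⟨w, hw⟩ := hF (x - f z) (by rw [smul_sub, ← hy, map_smul, sub_self])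
  refine ⟨g w, ?_⟩
  rw [← map_smul, hw, map_sub, (hfg _).2 ⟨z, rfl⟩, sub_zero]

theorem EpsExact.of_hasFlatDimLE {M : Type u} [AddCommGroup M] [Module (DualNumber k) M] {n : ℕ}
    (h : HasFlatDimLE (DualNumber k) M n) : EpsExact (k := k) M := by
  obtain ⟨F, _, _, d, ε, h1, h2, h3, h4, h5⟩ := h
  -- Induction on `j` descends through the syzygies, starting at `i > n`, where `F i` vanishes.
  have h6 : ∀ j i, n < i + j → EpsExact (k := k) (LinearMap.range (d i)) := by
    intro j
    induction j with
    | zero =>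
      intro i hi m _
      have := h2 i hi
      exact ⟨0, Subsingleton.elim _ _⟩
    | succ j ih =>
      intro i hi
      refine EpsExact.of_exact (f := (LinearMap.range (d (i + 1))).subtype)
        (g := (d i).rangeRestrict) (Submodule.subtype_injective _) (fun x => ?_)
        (LinearMap.surjective_rangeRestrict _) (ih (i + 1) (by omega)) (.of_isFlat (h1 _))
      rw [← (LinearMap.range (d i)).subtype_injective.eq_iff, map_zero]
      simpa using h3 i x
  refine EpsExact.of_exact (f := (LinearMap.range (d 0)).subtype) (g := ε)
    (Submodule.subtype_injective _) (fun x => ?_) h5 (h6 (n + 1) 0 (by omega)) (.of_isFlat (h1 _))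
  simpa using h4 x

/-- On the residue field `ε` acts as zero, so its kernel is not contained in its image. -/
theorem weakDim_dualNumber : weakDim (DualNumber k) = ⊤ := by
  let _ : Module (DualNumber k) k := Module.compHom k (TrivSqZeroExt.fstHom k k k).toRingHom
  rw [eq_top_iff]
  refine le_trans ?_ (le_iSup (fun M : ModuleCat.{u} (DualNumber k) => flatDim (DualNumber k) M)
    (ModuleCat.of (DualNumber k) k))
  refine le_iInf₂ fun n hn => ?_
  have h0 : ∀ x : k, (DualNumber.eps : DualNumber k) • x = 0 := fun x => by
    change TrivSqZeroExt.fst (DualNumber.eps : DualNumber k) * x = 0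
    simp
  obtain ⟨m, hm⟩ := EpsExact.of_hasFlatDimLE hn (1 : k) (h0 1)
  exact absurd ((h0 m).symm.trans hm) zero_ne_one

theorem exists_eq_add_tmul (M : Type u) [AddCommGroup M] [Module k M]
    (x : DualNumber k ⊗[k] M) :
    ∃ a b : M, x = 1 ⊗ₜ[k] a + (DualNumber.eps : DualNumber k) ⊗ₜ[k] b := by
  induction x using TensorProduct.induction_on with
  | zero => exact ⟨0, 0, by simp⟩
  | tmul r m =>
    refine ⟨r.fst • m, r.snd • m, ?_⟩
    rw [← TensorProduct.smul_tmul, ← TensorProduct.smul_tmul, ← TensorProduct.add_tmul]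
    congr 1
    ext <;> simp
  | add x y hx hy =>
    obtain ⟨a, b, rfl⟩ := hx
    obtain ⟨a', b', rfl⟩ := hy
    refine ⟨a + a', b + b', ?_⟩
    rw [TensorProduct.tmul_add, TensorProduct.tmul_add]
    abel

variable (M : Type u) [AddCommGroup M] [Module (DualNumber k) M] [Module k M]
  [IsScalarTower k (DualNumber k) M]

/-- The action map `k[ε] ⊗ M → M`. -/
noncomputable def actionMap : DualNumber k ⊗[k] M →ₗ[DualNumber k] M :=
  LinearMap.liftBaseChange (DualNumber k) (LinearMap.id : M →ₗ[k] M)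

variable {M} in
@[simp]
theorem actionMap_tmul (a : DualNumber k) (m : M) : actionMap M (a ⊗ₜ[k] m) = a • m := by
  simp [actionMap]

theorem actionMap_surjective : Function.Surjective (actionMap (k := k) M) := fun m =>
  ⟨1 ⊗ₜ m, by simp⟩

/-- The embedding `m ↦ ε ⊗ m + 1 ⊗ ε m` of a `k[ε]`-module into `k[ε] ⊗ M`. -/
noncomputable def coactionMap : M →ₗ[DualNumber k] DualNumber k ⊗[k] M where
  toFun m := (DualNumber.eps : DualNumber k) ⊗ₜ[k] m + 1 ⊗ₜ[k] ((DualNumber.eps : DualNumber k) • m)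
  map_add' m n := by
    rw [TensorProduct.tmul_add, smul_add, TensorProduct.tmul_add]
    abel
  map_smul' a m := by
    have ha : a = algebraMap k _ a.fst + algebraMap k _ a.snd * DualNumber.eps := by
      ext <;> simp [TrivSqZeroExt.algebraMap_eq_inl]
    have hk (c : k) (n : M) : (algebraMap k (DualNumber k) c) • n = c • n := algebraMap_smul _ _ _
    rw [ha, RingHom.id_apply]
    generalize a.fst = b
    generalize a.snd = c
    simp only [add_smul, mul_smul, hk, smul_add, TensorProduct.smul_tmul', smul_eq_mul, mul_one,
      TensorProduct.tmul_add, DualNumber.eps_mul_eps, TensorProduct.zero_tmul,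
      TensorProduct.tmul_smul]
    have hc (n : M) : (DualNumber.eps : DualNumber k) • c • n =
        c • (DualNumber.eps : DualNumber k) • n := by
      rw [← hk, ← hk, smul_smul, smul_smul, mul_comm]
    have hb (n : M) : (DualNumber.eps : DualNumber k) • b • n =
        b • (DualNumber.eps : DualNumber k) • n := by
      rw [← hk, ← hk, smul_smul, smul_smul, mul_comm]
    have hee (n : M) :
        (DualNumber.eps : DualNumber k) • (DualNumber.eps : DualNumber k) • n = 0 := by
      rw [smul_smul, DualNumber.eps_mul_eps, zero_smul]
    simp only [hc, hb, hee, smul_zero, TensorProduct.tmul_zero, TensorProduct.tmul_smul]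
    simp only [TensorProduct.smul_tmul', Algebra.smul_def, mul_one, add_zero]
    abel

variable {M} in
theorem coactionMap_apply (m : M) : coactionMap M m = (DualNumber.eps : DualNumber k) ⊗ₜ[k] m +
    1 ⊗ₜ[k] ((DualNumber.eps : DualNumber k) • m) := rfl

theorem coactionMap_injective : Function.Injective (coactionMap (k := k) M) := by
  -- The `ε`-coefficient of the image recovers `m`.
  apply Function.LeftInverse.injective
    (g := TensorProduct.lid k M ∘ (TrivSqZeroExt.sndHom k k).rTensor M)
  intro m
  simp [coactionMap_apply]

/-- The kernel of the action consists of `1 ⊗ a + ε ⊗ b` with `a = -ε b`; in characteristic 2 the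
sign disappears. -/
theorem coactionMap_actionMap_exact [CharP k 2] :
    Function.Exact (coactionMap (k := k) M) (actionMap (k := k) M) := by
  have h2 (m : M) : m + m = 0 := by
    rw [← two_smul k, show (2 : k) = 0 from CharP.cast_eq_zero k 2, zero_smul]
  intro x
  constructor
  · intro hx
    obtain ⟨a, b, rfl⟩ := exists_eq_add_tmul M x
    simp only [map_add, actionMap_tmul, one_smul] at hx
    refine ⟨b, ?_⟩
    rw [coactionMap_apply, (eq_neg_of_add_eq_zero_right hx).trans
      (neg_eq_of_add_eq_zero_right (h2 a)), add_comm]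
  · rintro ⟨m, rfl⟩
    simp [coactionMap_apply, h2]

/-- Injective modules over `k[ε]` are flat. -/
theorem flat_of_injective_dualNumber {I : Type u} [AddCommGroup I] [Module (DualNumber k) I]
    [Module (DualNumber k)ᵐᵒᵖ I] [IsCentralScalar (DualNumber k) I]
    (h : Module.Injective (DualNumber k)ᵐᵒᵖ I) : Module.Flat (DualNumber k) I := by
  let _ : Module k I := Module.compHom I (algebraMap k (DualNumber k))
  have : IsScalarTower k (DualNumber k) I :=
    ⟨fun c r m => by rw [Algebra.smul_def, mul_smul]; rfl⟩
  -- Injectivity splits the embedding of `I` into the flat module `k[ε] ⊗ I`.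
  obtain ⟨r, hr⟩ := h.out (rightMap (coactionMap (k := k) I)) (coactionMap_injective I)
    LinearMap.id
  exact Module.Flat.of_retract (coactionMap (k := k) I) (leftMap r) (LinearMap.ext hr)

/-- Over the dual numbers in characteristic two every module is Gorenstein flat. -/
theorem isGorensteinFlat_dualNumber [CharP k 2] (M : Type u) [AddCommGroup M]
    [Module (DualNumber k) M] : IsGorensteinFlat (DualNumber k) M := by
  let _ : Module k M := Module.compHom M (algebraMap k (DualNumber k))
  have : IsScalarTower k (DualNumber k) M :=
    ⟨fun c r m => by rw [Algebra.smul_def, mul_smul]; rfl⟩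
  let d := (coactionMap (k := k) M).comp (actionMap M)
  have hd : Function.Exact d d := by
    intro x
    change coactionMap M (actionMap M x) = 0 ↔ _
    rw [map_eq_zero_iff _ (coactionMap_injective M), coactionMap_actionMap_exact M x]
    constructor
    · rintro ⟨m, rfl⟩
      obtain ⟨y, rfl⟩ := actionMap_surjective (k := k) M m
      exact ⟨y, rfl⟩
    · rintro ⟨y, rfl⟩
      exact ⟨_, rfl⟩
  refine isGorensteinFlat_of_periodic d (isFlat_of_flat inferInstance) hd
    ((LinearEquiv.ofInjective _ (coactionMap_injective M)).trans (LinearEquiv.ofEq _ _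
      (LinearMap.range_comp_of_range_eq_top _
        (LinearMap.range_eq_top.2 (actionMap_surjective M))).symm)) (fun I _ _ hI => ?_)
  let _ := leftModule (DualNumber k) I
  have : IsCentralScalar (DualNumber k) I := ⟨fun _ _ => rfl⟩
  have := flat_of_injective_dualNumber hI
  exact tensor_exact_of_flat hd

end DualNumbers

/-! ### Local units in annihilators -/

section LocallyIdempotent

variable {A : Type u} [CommRing A] {M : Type u} [AddCommGroup M] [Module A M]

/-- Whenever `s m = 0`, the element `m` is fixed by an annihilator of `s`. -/
def HasAnnihilatorUnits (A : Type u) [CommRing A] (M : Type u) [AddCommGroup M] [Module A M] :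
    Prop :=
  ∀ (s : A) (m : M), s • m = 0 → ∃ e : A, e * s = 0 ∧ e • m = m

theorem HasAnnihilatorUnits.of_injective {N : Type u} [AddCommGroup N] [Module A N]
    (h : HasAnnihilatorUnits A M) (f : N →ₗ[A] M) (hf : Function.Injective f) :
    HasAnnihilatorUnits A N := by
  intro s n hn
  obtain ⟨e, he, hen⟩ := h s (f n) (by rw [← map_smul, hn, map_zero])
  exact ⟨e, he, hf (by rw [map_smul, hen])⟩

theorem HasAnnihilatorUnits.of_exact {N K : Type u} [AddCommGroup N] [Module A N]
    [AddCommGroup K] [Module A K] {f : K →ₗ[A] M} {g : M →ₗ[A] N}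
    (hf : Function.Injective f) (hfg : Function.Exact f g) (hK : HasAnnihilatorUnits A K)
    (hN : HasAnnihilatorUnits A N) : HasAnnihilatorUnits A M := by
  intro s m hm
  obtain ⟨e, he, hem⟩ := hN s (g m) (by rw [← map_smul, hm, map_zero])
  obtain ⟨x, hx⟩ := (hfg (m - e • m)).1 (by rw [map_sub, map_smul, hem, sub_self])
  obtain ⟨e', he', hex⟩ := hK s x (by
    apply hf
    rw [map_smul, hx, smul_sub, smul_smul, mul_comm, he, hm, zero_smul, sub_zero, map_zero])
  -- This is `1 - (1 - e')(1 - e)`: the factor `1 - e` moves `m` into `K`, where `1 - e'` kills it.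
  refine ⟨e + e' - e' * e, ?_, ?_⟩
  · rw [sub_mul, add_mul, he, he', mul_assoc, he]
    simp
  · have h1 := congrArg f hex
    rw [map_smul, hx, smul_sub, smul_smul] at h1
    rw [sub_smul, add_smul, add_sub_assoc, h1]
    abel

/-- The equational criterion writes `m` with coefficients annihilating `s`; finitely many of these
share a local unit, built up from `1 - (1 - e)(1 - e')`. -/
theorem HasAnnihilatorUnits.of_flat (hA : HasAnnihilatorUnits A A) [Module.Flat A M] :
    HasAnnihilatorUnits A M := by
  classical
  intro s m hm
  obtain ⟨k, b, y, rfl, hb⟩ := exists_sum_of_smul_eq_zero hm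
  have h : ∀ T : Finset (Fin k), ∃ e, e * s = 0 ∧ ∀ j ∈ T, e * b j = b j := by
    intro T
    induction T using Finset.induction_on with
    | empty => exact ⟨0, by simp, by simp⟩
    | insert j T _ ih =>
      obtain ⟨e, he, heT⟩ := ih
      obtain ⟨e', he', hej⟩ := hA s (b j) (hb j)
      rw [smul_eq_mul] at hej
      refine ⟨e + e' - e * e', by linear_combination (1 - e') * he + he', ?_⟩
      intro i hi
      rcases Finset.mem_insert.1 hi with rfl | hi
      · linear_combination (1 - e) * hej
      · linear_combination (1 - e') * heT i hi
  obtain ⟨e, he, heb⟩ := h Finset.univ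
  refine ⟨e, he, ?_⟩
  rw [Finset.smul_sum]
  refine Finset.sum_congr rfl fun j hj => ?_
  rw [smul_smul, heb j hj]

/-- Finitely generated ideals are principal, so each tensor is `s ⊗ m`. If `s m = 0`, then `s ⊗ m =
s ⊗ e m = e s ⊗ m = 0`. -/
theorem HasAnnihilatorUnits.flat [IsBezout A] (h : HasAnnihilatorUnits A M) :
    Module.Flat A M := by
  rw [Module.Flat.iff_rTensor_injective]
  intro I hI
  obtain ⟨s, rfl⟩ := (IsBezout.isPrincipal_of_FG I hI).principal
  let g : Submodule.span A {s} := ⟨s, Submodule.mem_span_singleton_self s⟩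
  have key : ∀ x : Submodule.span A {s} ⊗[A] M, ∃ m : M, x = g ⊗ₜ m := by
    intro x
    induction x using TensorProduct.induction_on with
    | zero => exact ⟨0, by simp⟩
    | tmul a m =>
      obtain ⟨a, ha⟩ := a
      obtain ⟨c, rfl⟩ := Submodule.mem_span_singleton.1 ha
      exact ⟨c • m, by rw [← TensorProduct.smul_tmul]; rfl⟩
    | add x y hx hy =>
      obtain ⟨m, rfl⟩ := hx
      obtain ⟨n, rfl⟩ := hy
      exact ⟨m + n, by rw [TensorProduct.tmul_add]⟩
  rw [injective_iff_map_eq_zero]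
  intro x hx
  obtain ⟨m, rfl⟩ := key x
  have hm := congrArg (TensorProduct.lid A M) hx
  simp only [LinearMap.rTensor_tmul, TensorProduct.lid_tmul, map_zero] at hm
  obtain ⟨e, he, hem⟩ := h s m hm
  rw [← hem, ← TensorProduct.smul_tmul,
    show e • g = 0 from Subtype.ext he, TensorProduct.zero_tmul]

/-- A Bézout ring in which annihilators have local units is left GF-closed: its Gorenstein flat
modules are flat. -/
theorem isLeftGFClosed_of_hasAnnihilatorUnits [IsBezout A] (h : HasAnnihilatorUnits A A) :
    IsLeftGFClosed A := by
  have key (N : Type u) [AddCommGroup N] [Module A N] (hN : IsGorensteinFlat A N) :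
      HasAnnihilatorUnits A N := by
    obtain ⟨F, _, _, d, h1, _, ⟨e⟩, _⟩ := hN
    -- A Gorenstein flat module embeds in the flat module `F^0`.
    have := flat_of_isFlat (h1 (0 + 1))
    exact (HasAnnihilatorUnits.of_flat (M := F (0 + 1)) h).of_injective
      ((LinearMap.range (d 0)).subtype.comp e.toLinearMap)
      ((Submodule.subtype_injective _).comp e.injective)
  intro K L N _ _ _ _ _ _ f g hf hfg _ hK hN
  exact (isFlat_of_flat (HasAnnihilatorUnits.of_exact hf hfg (key K hK)
    (key N hN)).flat).isGorensteinFlat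

end LocallyIdempotent

/-! ### A GF-closed ring that is not coherent -/

section EventuallyConstant

/-- The ring of pairs `(n, a)` with `n` an integer and `a` a sequence in `𝔽₂` that is eventually
equal to the residue of `n`. -/
def EventuallyResidue : Subring (ℤ × (ULift.{u} ℕ → ZMod 2)) where
  carrier := {x | ∃ N : ℕ, ∀ i, N ≤ i.down → x.2 i = (x.1 : ZMod 2)}
  one_mem' := ⟨0, fun i _ => by simp⟩
  zero_mem' := ⟨0, fun i _ => by simp⟩
  mul_mem' := by
    rintro x y ⟨N, hN⟩ ⟨N', hN'⟩
    exact ⟨max N N', fun i hi => by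
      simp [hN i (le_trans (le_max_left _ _) hi), hN' i (le_trans (le_max_right _ _) hi)]⟩
  add_mem' := by
    rintro x y ⟨N, hN⟩ ⟨N', hN'⟩
    exact ⟨max N N', fun i hi => by
      simp [hN i (le_trans (le_max_left _ _) hi), hN' i (le_trans (le_max_right _ _) hi)]⟩
  neg_mem' := by
    rintro x ⟨N, hN⟩
    exact ⟨N, fun i hi => by simp [hN i hi]⟩

namespace EventuallyResidue

/-- The element with integer part `n` and sequence `f` up to `N`. -/
def mk (n : ℤ) (N : ℕ) (f : ULift.{u} ℕ → ZMod 2) : EventuallyResidue.{u} :=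
  ⟨(n, fun i => if i.down < N then f i else n), N, fun i hi => by simp [not_lt.2 hi]⟩

theorem ext' {x y : EventuallyResidue.{u}} (h : x.1.1 = y.1.1) (h' : ∀ i, x.1.2 i = y.1.2 i) :
    x = y := Subtype.ext (Prod.ext h (funext h'))

/-- One of the integers `n`, `m` is zero. If `m = 0`, the fixed element is idempotent and serves as
its own unit; otherwise `n = 0` and `(1, 1 - a)` works. -/
theorem hasAnnihilatorUnits : HasAnnihilatorUnits EventuallyResidue.{u} EventuallyResidue.{u} := by
  rintro ⟨⟨n, a⟩, N, ha⟩ ⟨⟨m, b⟩, N', hb⟩ h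
  have h1 : n * m = 0 := congrArg (fun x => x.1.1) h
  have h2 (i) : a i * b i = 0 := congrArg (fun x => x.1.2 i) h
  have sq : ∀ z : ZMod 2, z * z = z := by decide
  by_cases hm : m = 0
  · subst hm
    refine ⟨⟨(0, b), N', hb⟩, ext' (zero_mul n) fun i => ?_, ext' (zero_mul _) fun i => ?_⟩
    · exact (mul_comm _ _).trans (h2 i)
    · exact sq _
  · obtain rfl : n = 0 := (mul_eq_zero.1 h1).resolve_right hm
    refine ⟨⟨(1, fun i => 1 - a i), N, fun i hi => ?_⟩, ext' (mul_zero _) fun i => ?_,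
      ext' (one_mul _) fun i => ?_⟩
    · have : a i = 0 := by simpa using ha i hi
      simp [this]
    · change (1 - a i) * a i = 0
      linear_combination -sq (a i)
    · change (1 - a i) * b i = b i
      linear_combination -h2 i

/-- Beyond a common index `L` the generator is the gcd; below `L`, coordinatewise in `𝔽₂`, it is the
join `a + b + ab`. -/
instance : IsBezout EventuallyResidue.{u} := by
  rw [IsBezout.iff_span_pair_isPrincipal]
  rintro ⟨⟨n, a⟩, N, ha⟩ ⟨⟨m, b⟩, N', hb⟩
  obtain ⟨L, ha', hb'⟩ : ∃ L : ℕ, (∀ i, ¬ i.down < L → a i = n) ∧ ∀ i, ¬ i.down < L → b i = m :=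
    ⟨max N N', fun i hi => ha i (le_trans (le_max_left _ _) (not_lt.1 hi)),
      fun i hi => hb i (le_trans (le_max_right _ _) (not_lt.1 hi))⟩
  obtain ⟨n', hn⟩ := Int.gcd_dvd_left n m
  obtain ⟨m', hm⟩ := Int.gcd_dvd_right n m
  have hg := Int.gcd_eq_gcd_ab n m
  generalize (Int.gcd n m : ℤ) = g at *
  generalize Int.gcdA n m = u at *
  generalize Int.gcdB n m = v at *
  have hn2 : (n : ZMod 2) = g * n' := by rw [← Int.cast_mul, ← hn]
  have hm2 : (m : ZMod 2) = g * m' := by rw [← Int.cast_mul, ← hm]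
  have hg2 : (g : ZMod 2) = n * u + m * v := by
    rw [← Int.cast_mul, ← Int.cast_mul, ← Int.cast_add, ← hg]
  have e1 : ∀ x y : ZMod 2, x = (x + y + x * y) * x := by decide
  have e2 : ∀ x y : ZMod 2, y = (x + y + x * y) * y := by decide
  have e3 : ∀ x y : ZMod 2, x * 1 + y * (1 + x) = x + y + x * y := by decide
  refine ⟨⟨mk g L (fun i => a i + b i + a i * b i), le_antisymm ?_ ?_⟩⟩
  · rw [Ideal.span_le]
    rintro _ (rfl | rfl)
    · refine Ideal.mem_span_singleton.2 ⟨mk n' L a, ext' hn fun i => ?_⟩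
      by_cases hi : i.down < L
      · simpa [mk, hi] using e1 (a i) (b i)
      · have := ha' i hi
        simp [mk, hi, this, hn2]
    · refine Ideal.mem_span_singleton.2 ⟨mk m' L b, ext' hm fun i => ?_⟩
      by_cases hi : i.down < L
      · simpa [mk, hi] using e2 (a i) (b i)
      · have := hb' i hi
        simp [mk, hi, this, hm2]
  · refine (Ideal.span_singleton_le_iff_mem _).2 (Ideal.mem_span_pair.2
      ⟨mk u L (fun _ => 1), mk v L (fun i => 1 + a i), ext' ?_ fun i => ?_⟩)
    · change u * n + v * m = g
      rw [hg]; ring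
    · by_cases hi : i.down < L
      · simpa [mk, hi, mul_comm] using e3 (a i) (b i)
      · have h1 := ha' i hi
        have h2 := hb' i hi
        simp [mk, hi, h1, h2, hg2, mul_comm]

theorem not_isRightCoherent : ¬ IsRightCoherent EventuallyResidue.{u} := by
  intro h
  -- This is `(2, 0)`: with cutoff `0` every entry is the residue of `2`.
  let s : EventuallyResidue.{u} := mk 2 0 0
  let I := Submodule.span EventuallyResidue.{u}ᵐᵒᵖ {s}
  have hI : Module.FinitePresentation EventuallyResidue.{u}ᵐᵒᵖ I :=
    h I (Submodule.fg_span_singleton s)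
  let l : EventuallyResidue.{u}ᵐᵒᵖ →ₗ[EventuallyResidue.{u}ᵐᵒᵖ] I :=
    LinearMap.toSpanSingleton _ _ ⟨s, Submodule.mem_span_singleton_self s⟩
  have hl : Function.Surjective l := by
    rintro ⟨x, hx⟩
    obtain ⟨c, rfl⟩ := Submodule.mem_span_singleton.1 hx
    exact ⟨c, rfl⟩
  have hmem (x : EventuallyResidue.{u}ᵐᵒᵖ) : x ∈ LinearMap.ker l ↔ s * x.unop = 0 := by
    rw [LinearMap.mem_ker, ← Subtype.coe_inj]
    rfl
  obtain ⟨T, hT⟩ := Module.FinitePresentation.fg_ker l hl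
  have hT0 : ∀ x ∈ T, ∃ N : ℕ, ∀ i, N ≤ i.down → x.unop.1.2 i = 0 := by
    intro x hx
    have h1 : x ∈ LinearMap.ker l := hT ▸ Submodule.subset_span hx
    have h2 : (2 : ℤ) * x.unop.1.1 = 0 := congrArg (fun y => y.1.1) ((hmem x).1 h1)
    obtain ⟨N, hN⟩ := x.unop.2
    refine ⟨N, fun i hi => ?_⟩
    rw [hN i hi, (mul_eq_zero.1 h2).resolve_left two_ne_zero, Int.cast_zero]
  choose! B hB using hT0
  -- Finitely many generators bound the support of the whole annihilator.
  have hker : ∀ x ∈ LinearMap.ker l, ∀ i : ULift.{u} ℕ, T.sup B ≤ i.down → x.unop.1.2 i = 0 := by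
    intro x hx i hi
    rw [← hT] at hx
    induction hx using Submodule.span_induction with
    | mem x hx => exact hB x hx i (le_trans (Finset.le_sup hx) hi)
    | zero => rfl
    | add x y _ _ hx hy =>
      change x.unop.1.2 i + y.unop.1.2 i = 0
      rw [hx, hy, add_zero]
    | smul r x _ hx =>
      change x.unop.1.2 i * r.unop.1.2 i = 0
      rw [hx, zero_mul]
  -- This annihilator element still has entry `1` at the index `T.sup B`.
  have h1 := hker (MulOpposite.op (mk 0 (T.sup B + 1) 1)) ((hmem _).2 (ext' (mul_zero _) fun i => by
    change ((s : ℤ × (ULift.{u} ℕ → ZMod 2)).2 i) * _ = 0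
    have : (s : ℤ × (ULift.{u} ℕ → ZMod 2)).2 i = 0 := by
      simp [s, mk]; rfl
    rw [this, zero_mul])) ⟨T.sup B⟩ le_rfl
  simp [mk] at h1

end EventuallyResidue

end EventuallyConstant

end GFRing

theorem mainTheorem10 :
    (∀ (R S : Type u) [Ring R] [Ring S],
      GFRing.IsLeftGFClosed R → GFRing.weakDim R = ⊤ →
      GFRing.IsLeftGFClosed S → ¬ GFRing.IsRightCoherent S →
        GFRing.IsLeftGFClosed (R × S) ∧
        (GFRing.weakDim (R × S) = max (GFRing.weakDim R) (GFRing.weakDim S) ∧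
          GFRing.weakDim (R × S) = ⊤) ∧
        ¬ GFRing.IsRightCoherent (R × S)) ∧
    (∃ (R : Type u) (_ : Ring R), GFRing.IsLeftGFClosed R ∧ GFRing.weakDim R = ⊤) ∧
    (∃ (S : Type u) (_ : Ring S), GFRing.IsLeftGFClosed S ∧ ¬ GFRing.IsRightCoherent S) := by
  refine ⟨fun R S _ _ hR hRw hS hSc => ?_, ?_, ?_⟩
  · have h1 : GFRing.weakDim (R × S) = ⊤ :=
      top_le_iff.1 (hRw ▸ (GFRing.RingFactor.fst R S).weakDim_le)
    exact ⟨hR.prod hS, ⟨by rw [h1, hRw, max_eq_left le_top], h1⟩,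
      fun h => hSc ((GFRing.RingFactor.snd R S).isRightCoherent h)⟩
  -- `ULift` places `𝔽₂` in the universe `u`.
  · have : CharP (ULift.{u} (ZMod 2)) 2 := inferInstance
    exact ⟨DualNumber (ULift.{u} (ZMod 2)), inferInstance,
      fun _ B _ _ _ _ _ _ _ _ _ _ _ _ _ _ => GFRing.isGorensteinFlat_dualNumber B,
      GFRing.weakDim_dualNumber⟩
  · exact ⟨GFRing.EventuallyResidue.{u}, inferInstance,
      GFRing.isLeftGFClosed_of_hasAnnihilatorUnits GFRing.EventuallyResidue.hasAnnihilatorUnits,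
      GFRing.EventuallyResidue.not_isRightCoherent⟩
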